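/- Theorem 3 (Almost sure uniqueness). Let $d\ge 1$, let $|\cdot|$ be the Euclidean norm and $\mathcal L$ Lebesgue measure on $\mathbb R^d$. For a set $\Xi\subseteq\mathbb R^d$ (of *centers*) and $\alpha\in[0,\infty]$, an *allocation* to $\Xi$ with appetite $\alpha$ is a measurable function $\psi:\mathbb R^d\to\Xi\cup\{\infty,\Delta\}$ with $\mathcal L[\psi^{-1}(\Delta)]=0$ and $\mathcal L[\psi^{-1}(\xi)]\le\alpha$ for all $\xi\in\Xi$. For $x\in\mathbb R^d$ and $\xi\in\Xi$ with $\psi(x)\notin\{\xi,\Delta\}$, the pair $(x,\xi)$ is *unstable* if both (a) $\psi(x)=\infty$ or $|x-\xi|<|x-\psi(x)|$, and (b) $\mathcal L[\psi^{-1}(\xi)]\neq\alpha$ or $|x-\xi|<|x'-\xi|$ for some $x'\in\psi^{-1}(\xi)$. An allocation is *stable* if there are no unstable pairs. Let $\Pi$ be a simple point process on $\mathbb R^d$ whose law is invariant under translations and whose intensity (mean number of points per unit volume) is finite, let $\mathbf P$ be the underlying probability measure, let $[\pi]=\{z:\pi(\{z\})=1\}$ denote the support of a simple point measure $\pi$,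 and let $\alpha\in(0,\infty)$. Then: 1. $\mathbf P$-a.s. there exists a stable allocation to $[\Pi]$ with appetite $\alpha$, and any two such stable allocations agree $\mathcal L$-a.e. 2. This allocation can be chosen to be a measurable, isometry-equivariant factor of $\Pi$: there are a measurable set $D$ of simple point measures, with $\Pi\in D$ a.s. and $T\pi\in D\iff\pi\in D$ for every isometry $T$ of $\mathbb R^d$, and a map assigning to each $\pi\in D$ an allocation $\Psi_\pi$ to $[\pi]$ with appetite $\alpha$, such that $(\pi,x)\mapsto\Psi_\pi(x)$ is measurable, $\Psi_{T\pi}(Tx)=T\Psi_\pi(x)$ for all $\pi\in D$, all $x\in\mathbb R^d$ and all isometries $T$ (with $T\infty=\infty$, $T\Delta=\Delta$), and $\Psi_\Pi$ is $\mathbf P$-a.s. a stable allocation to $[\Pi]$. -/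

import Mathlib

open MeasureTheory Set
open scoped ENNReal

namespace StableMarriage

/-- The space of sites `ℝ^d`, with the Euclidean norm, its Borel σ-algebra and Lebesgue measure
`volume`. -/
abbrev Site (d : ℕ) : Type := EuclideanSpace ℝ (Fin d)

/-- The values of an allocation: a center `ξ`, the symbol `∞` (the site is unclaimed), or the
symbol `Δ` (the allocation is undefined at the site). -/
inductive Allot (d : ℕ) : Type where
  | center (ξ : Site d) : Allot d
  | unclaimed : Allot d
  | undefined : Allot d

namespace Allot

variable {d : ℕ}

/-- The disjoint-union σ-algebra on `ℝ^d ∪ {∞, Δ}`: a set is measurable iff its part in `ℝ^d`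
is Borel. -/
instance : MeasurableSpace (Allot d) :=
  MeasurableSpace.map Allot.center inferInstance

/-- A map of `ℝ^d` acts on `ℝ^d ∪ {∞, Δ}`, fixing `∞` and `Δ`. -/
def map (T : Site d → Site d) : Allot d → Allot d
  | center ξ => center (T ξ)
  | unclaimed => unclaimed
  | undefined => undefined

end Allot

section Allocations

variable {d : ℕ}

/-- `ψ` is an allocation of `ℝ^d` to the set of centers `Ξ` with appetite `α`: a measurable
function with values in `Ξ ∪ {∞, Δ}`, undefined only on a Lebesgue-null set, such that every
territory has volume at most `α`. -/
structure IsAllocation (α : ℝ≥0∞) (Ξ : Set (Site d)) (ψ : Site d → Allot d) : Prop where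
  measurable : Measurable ψ
  mem_centers : ∀ x ξ, ψ x = Allot.center ξ → ξ ∈ Ξ
  undefined_null : volume (ψ ⁻¹' {Allot.undefined}) = 0
  territory_le : ∀ ξ ∈ Ξ, volume (ψ ⁻¹' {Allot.center ξ}) ≤ α

/-- The center `ξ` is sated: its territory has volume exactly `α`. -/
def IsSated (α : ℝ≥0∞) (ψ : Site d → Allot d) (ξ : Site d) : Prop :=
  volume (ψ ⁻¹' {Allot.center ξ}) = α

/-- The site `x` desires the center `ξ`: it is claimed by a center strictly further away
than `ξ`, or it is unclaimed. -/
def Desires (ψ : Site d → Allot d) (x ξ : Site d) : Prop :=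
  (∃ ζ, ψ x = Allot.center ζ ∧ dist x ξ < dist x ζ) ∨ ψ x = Allot.unclaimed

/-- The center `ξ` covets the site `x`: some site of its territory is strictly further away
than `x`, or `ξ` is unsated. -/
def Covets (α : ℝ≥0∞) (ψ : Site d → Allot d) (ξ x : Site d) : Prop :=
  (∃ x', ψ x' = Allot.center ξ ∧ dist x ξ < dist x' ξ) ∨ ¬ IsSated α ψ ξ

/-- `(x, ξ)` is an unstable pair for `ψ`. -/
def IsUnstablePair (α : ℝ≥0∞) (ψ : Site d → Allot d) (x ξ : Site d) : Prop :=
  ψ x ≠ Allot.center ξ ∧ ψ x ≠ Allot.undefined ∧ Desires ψ x ξ ∧ Covets α ψ ξ x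

/-- `ψ` is a stable allocation to `Ξ` with appetite `α`: an allocation with no unstable pair
of a site and a center. -/
def IsStableAllocation (α : ℝ≥0∞) (Ξ : Set (Site d)) (ψ : Site d → Allot d) : Prop :=
  IsAllocation α Ξ ψ ∧ ∀ x, ∀ ξ ∈ Ξ, ¬ IsUnstablePair α ψ x ξ

end Allocations

section PointProcesses

variable {d : ℕ} {Ω : Type*} [MeasurableSpace Ω]

/-- A simple point measure: the counting measure of a countable set of points. (Local
finiteness is not required here; for a point process of finite intensity it holds almost surely.) -/
def IsSimplePointMeasure (π : Measure (Site d)) : Prop :=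
  ∃ S : Set (Site d), S.Countable ∧ π = Measure.count.restrict S

/-- The support `[π]` of a simple point measure. -/
def support (π : Measure (Site d)) : Set (Site d) :=
  {z | π {z} = 1}

/-- A simple point process on `ℝ^d`: a random measure which is almost surely a simple point
measure. Measurability is with respect to the σ-algebra on measures generated by the evaluations
`π ↦ π A`, `A` Borel. -/
structure IsSimplePointProcess (P : Measure Ω) (X : Ω → Measure (Site d)) : Prop where
  measurable : Measurable X
  ae_simple : ∀ᵐ ω ∂P, IsSimplePointMeasure (X ω)

/-- The law of the process is invariant under all translations of `ℝ^d`. -/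
def IsTranslationInvariant (P : Measure Ω) (X : Ω → Measure (Site d)) : Prop :=
  ∀ v : Site d,
    P.map (fun ω => (X ω).map (IsometryEquiv.addRight v)) = P.map X

/-- The intensity: the mean number of points in the unit cube `[0,1)^d`. -/
noncomputable def intensity (P : Measure Ω) (X : Ω → Measure (Site d)) : ℝ≥0∞ :=
  ∫⁻ ω, X ω {x | ∀ i, x i ∈ Ico (0 : ℝ) 1} ∂P

/-- `Ψ`, defined on the set `D` of measures, is equivariant under the isometry `T`: `D` is
`T`-invariant and `Ψ_{Tπ}(Tx) = T(Ψ_π(x))` (with `T∞ = ∞` and `TΔ = Δ`). -/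
def IsEquivariantUnder (D : Set (Measure (Site d))) (Ψ : Measure (Site d) → Site d → Allot d)
    (T : Site d ≃ᵢ Site d) : Prop :=
  (∀ π : Measure (Site d), π.map T ∈ D ↔ π ∈ D) ∧
    ∀ π ∈ D, ∀ x, Ψ (π.map T) (T x) = (Ψ π x).map T

/-- `Ψ` with domain of definition `D` is a factor allocation (with appetite `α`) of the point
process `X`: `D` is a measurable set of simple point measures of full probability, to each
`π ∈ D` an allocation `Ψ π` to `[π]` is assigned, `(π, x) ↦ Ψ_π(x)` is jointly measurable
on `D × ℝ^d`, and `Ψ` is translation-equivariant. The values of `Ψ` outside `D` are irrelevant. -/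
structure IsFactorAllocation (α : ℝ≥0∞) (P : Measure Ω) (X : Ω → Measure (Site d))
    (D : Set (Measure (Site d))) (Ψ : Measure (Site d) → Site d → Allot d) : Prop where
  measurableSet_domain : MeasurableSet D
  domain_simple : ∀ π ∈ D, IsSimplePointMeasure π
  ae_mem_domain : ∀ᵐ ω ∂P, X ω ∈ D
  isAllocation : ∀ π ∈ D, IsAllocation α (support π) (Ψ π)
  measurable : Measurable (fun p : D × Site d => Ψ p.1 p.2)
  translation_equivariant : ∀ v : Site d, IsEquivariantUnder D Ψ (IsometryEquiv.addRight v)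

/-- `Ψ` with domain of definition `D` is equivariant under all isometries of `ℝ^d`. -/
def IsIsometryEquivariant (D : Set (Measure (Site d)))
    (Ψ : Measure (Site d) → Site d → Allot d) : Prop :=
  ∀ T : Site d ≃ᵢ Site d, IsEquivariantUnder D Ψ T

end PointProcesses

end StableMarriage

/-! Radii `R ξ ∈ [0, ∞]` define an allocation: each site goes to the nearest center among those
whose radius exceeds its distance. Call the radii balanced if every cell has volume at most `α`,
with equality wherever the radius is finite. Balanced radii give a stable allocation
(`IsBalanced.isStableAllocation`), and every stable allocation arises a.e. from balanced radii
(`IsStableAllocation.isBalanced_reach`).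

Enlarging the other radii leaves fewer sites to `ξ`, so the radius at which `ξ` fills up can only
grow: updating radii is a monotone operation. Iterating it down from `⊤` and up from `0`, the
continuum Gale–Shapley algorithm with sites or centers proposing, produces balanced radii that bound
all balanced radii from above and below.

Sites do best under the large radii, centers under the small ones. Both preferences are measured by
the same score `(1 + distance)⁻¹`. For a translation-invariant process the mean score weighted at
sites equals the mean score weighted at centers (`lintegral_mul_score_eq`), so the two opposite
inequalities force the extremal allocations to give almost every site the same distance
(`ae_score_centerRadius_eq_score_siteRadius`). Any stable allocation is squeezed between them, and
since equidistant sites form a null set, equal distance means equal center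
(`IsStableAllocation.ae_eq_alloc_siteRadius`).

The site-optimal radii are built from the point set by distances, volumes and countable limits only.
The resulting allocation is therefore isometry-equivariant and jointly measurable on the set of
locally finite simple point measures, which the process almost surely belongs to. -/

namespace StableMarriage

/-! ### Null sets of ties, and locally finite sets of centers. -/

section Geometry

variable {d : ℕ}

theorem site_nontrivial (hd : 1 ≤ d) : Nontrivial (Site d) := by
  have : Nonempty (Fin d) := ⟨⟨0, hd⟩⟩
  infer_instance

theorem measurableSet_setOf_edist_lt (ξ : Site d) (r : ℝ≥0∞) :
    MeasurableSet {x : Site d | edist x ξ < r} :=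
  measurableSet_lt (by fun_prop) measurable_const

theorem volume_setOf_edist_lt_lt_top (ξ : Site d) {r : ℝ≥0∞} (hr : r ≠ ⊤) :
    volume {x : Site d | edist x ξ < r} < ⊤ := by
  lift r to NNReal using hr
  refine (measure_mono ?_).trans_lt (measure_closedBall_lt_top (x := ξ) (r := r))
  intro x hx
  have : edist x ξ ≤ r := le_of_lt hx
  rw [edist_le_coe] at this
  simpa [Metric.mem_closedBall] using this

theorem volume_setOf_edist_eq (hd : 1 ≤ d) (ξ : Site d) {r : ℝ≥0∞} :
    volume {x : Site d | edist x ξ = r} = 0 := by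
  have := site_nontrivial hd
  by_cases hr : r = ⊤
  · subst hr
    simp [edist_ne_top]
  lift r to NNReal using hr
  rw [← Measure.addHaar_sphere (μ := volume) ξ r]
  congr 1
  ext x
  simp only [mem_ofPred_eq, Metric.mem_sphere, edist_nndist, ENNReal.coe_inj, dist_nndist,
    NNReal.coe_inj]

theorem volume_setOf_edist_eq_edist {ξ η : Site d} (h : ξ ≠ η) :
    volume {x : Site d | edist x ξ = edist x η} = 0 := by
  have := Measure.addHaar_affineSubspace (volume : Measure (Site d))
    (AffineSubspace.perpBisector ξ η) (by simpa using h)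
  rw [← this]
  congr 1
  ext x
  simp [AffineSubspace.mem_perpBisector_iff_dist_eq, edist_dist, ENNReal.ofReal_eq_ofReal_iff]

theorem ae_edist_ne (hd : 1 ≤ d) {Ξ : Set (Site d)} (hΞ : Ξ.Countable) (R : Site d → ℝ≥0∞) :
    ∀ᵐ x : Site d, ∀ ξ ∈ Ξ, edist x ξ ≠ R ξ := by
  rw [ae_ball_iff hΞ]
  intro ξ _
  simpa [ae_iff] using volume_setOf_edist_eq hd ξ

theorem ae_edist_ne_edist {Ξ : Set (Site d)} (hΞ : Ξ.Countable) :
    ∀ᵐ x : Site d, ∀ ξ ∈ Ξ, ∀ η ∈ Ξ, ξ ≠ η → edist x ξ ≠ edist x η := by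
  rw [ae_ball_iff hΞ]
  intro ξ _
  rw [ae_ball_iff hΞ]
  intro η _
  by_cases h : ξ = η
  · simp [h]
  · simpa [ae_iff, h] using volume_setOf_edist_eq_edist h

/-- Every bounded region contains finitely many points of the set. -/
def IsLocallyFinite (Ξ : Set (Site d)) : Prop :=
  ∀ (x : Site d) (r : ℝ), (Ξ ∩ Metric.closedBall x r).Finite

theorem IsLocallyFinite.countable {Ξ : Set (Site d)} (h : IsLocallyFinite Ξ) : Ξ.Countable := by
  have : Ξ = ⋃ n : ℕ, Ξ ∩ Metric.closedBall 0 n := by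
    rw [← inter_iUnion, Metric.iUnion_closedBall_nat, inter_univ]
  rw [this]
  exact countable_iUnion fun n => (h 0 n).countable

theorem IsLocallyFinite.finite_setOf_edist_le {Ξ : Set (Site d)} (h : IsLocallyFinite Ξ)
    (x ξ : Site d) : {η ∈ Ξ | edist x η ≤ edist x ξ}.Finite := by
  refine (h x (dist x ξ)).subset ?_
  rintro η ⟨hη, hd⟩
  refine ⟨hη, ?_⟩
  rw [edist_dist, edist_dist, ENNReal.ofReal_le_ofReal_iff dist_nonneg] at hd
  rwa [Metric.mem_closedBall, dist_comm]

theorem IsLocallyFinite.exists_nearest {Ξ : Set (Site d)} (h : IsLocallyFinite Ξ) (x : Site d)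
    {p : Site d → Prop} (hp : ∃ ξ ∈ Ξ, p ξ) :
    ∃ ξ ∈ Ξ, p ξ ∧ ∀ η ∈ Ξ, p η → edist x ξ ≤ edist x η := by
  obtain ⟨ζ, hζ, hpζ⟩ := hp
  obtain ⟨ξ, ⟨⟨hξ, hξζ⟩, hpξ⟩, hmin⟩ :=
    Set.exists_min_image ({η ∈ Ξ | edist x η ≤ edist x ζ} ∩ {η | p η}) (fun η => edist x η)
      ((h.finite_setOf_edist_le x ζ).inter_of_left _) ⟨ζ, ⟨hζ, le_rfl⟩, hpζ⟩
  refine ⟨ξ, hξ, hpξ, fun η hη hpη => ?_⟩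
  by_cases hle : edist x η ≤ edist x ζ
  · exact hmin η ⟨⟨hη, hle⟩, hpη⟩
  · exact hξζ.trans (not_le.mp hle).le

end Geometry

/-! ### Balanced radii and the two extremal families. -/

section Radii

variable {d : ℕ}

/-- The sites which strictly prefer `ξ` to every other center `η` whose reach `R η` they lie
within. -/
def availableSites (Ξ : Set (Site d)) (R : Site d → ℝ≥0∞) (ξ : Site d) : Set (Site d) :=
  {x | ∀ η ∈ Ξ, η ≠ ξ → edist x η < R η → edist x ξ < edist x η}

/-- The sites claimed by `ξ` when every center `η` accepts exactly the sites at distance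
less than `R η`. -/
def cell (Ξ : Set (Site d)) (R : Site d → ℝ≥0∞) (ξ : Site d) : Set (Site d) :=
  availableSites Ξ R ξ ∩ {x | edist x ξ < R ξ}

theorem measurableSet_availableSites {Ξ : Set (Site d)} (hΞ : Ξ.Countable) (R : Site d → ℝ≥0∞)
    (ξ : Site d) : MeasurableSet (availableSites Ξ R ξ) := by
  have : availableSites Ξ R ξ =
      ⋂ η ∈ Ξ, {x | η ≠ ξ → edist x η < R η → edist x ξ < edist x η} := by
    ext; simp [availableSites]
  rw [this]
  refine MeasurableSet.biInter hΞ fun η _ => ?_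
  refine (MeasurableSet.const _).imp ((measurableSet_setOf_edist_lt η _).imp ?_)
  exact measurableSet_lt (by fun_prop) (by fun_prop)

theorem measurableSet_cell {Ξ : Set (Site d)} (hΞ : Ξ.Countable) (R : Site d → ℝ≥0∞)
    (ξ : Site d) : MeasurableSet (cell Ξ R ξ) :=
  (measurableSet_availableSites hΞ R ξ).inter (measurableSet_setOf_edist_lt ξ _)

theorem availableSites_anti {Ξ : Set (Site d)} {R R' : Site d → ℝ≥0∞}
    (h : ∀ η ∈ Ξ, R η ≤ R' η) (ξ : Site d) : availableSites Ξ R' ξ ⊆ availableSites Ξ R ξ :=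
  fun _ hx η hη hne hlt => hx η hη hne (hlt.trans_le (h η hη))

theorem eq_of_mem_cell {Ξ : Set (Site d)} {R : Site d → ℝ≥0∞} {ξ η x : Site d} (hξ : ξ ∈ Ξ)
    (hη : η ∈ Ξ) (hxξ : x ∈ cell Ξ R ξ) (hxη : x ∈ cell Ξ R η) : ξ = η := by
  by_contra hne
  exact lt_asymm (hxξ.1 η hη (Ne.symm hne) hxη.2) (hxη.1 ξ hξ hne hxξ.2)

theorem ae_exists_mem_cell {Ξ : Set (Site d)} (hΞ : IsLocallyFinite Ξ) (R : Site d → ℝ≥0∞) :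
    ∀ᵐ x : Site d, (∃ ξ ∈ Ξ, edist x ξ < R ξ) → ∃ ξ ∈ Ξ, x ∈ cell Ξ R ξ := by
  filter_upwards [ae_edist_ne_edist hΞ.countable] with x hx hex
  obtain ⟨ξ, hξ, hlt, hmin⟩ := hΞ.exists_nearest x hex
  exact ⟨ξ, hξ, fun η hη hne hη' => (hmin η hη hη').lt_of_ne (hx ξ hξ η hη hne.symm), hlt⟩

/-- A rational radius. -/
noncomputable def ratRadius (q : ℚ) : ℝ≥0∞ := ((q : ℝ).toNNReal : ℝ≥0∞)

theorem ratRadius_ne_top (q : ℚ) : ratRadius q ≠ ⊤ := ENNReal.coe_ne_top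

theorem exists_ratRadius_btwn {a b : ℝ≥0∞} (h : a < b) : ∃ q, a < ratRadius q ∧ ratRadius q < b := by
  obtain ⟨q, _, h1, h2⟩ := ENNReal.lt_iff_exists_rat_btwn.1 h
  exact ⟨q, h1, h2⟩

/-- The largest reach of `ξ` for which the volume it claims satisfies `p`, the other
centers keeping the reach `R`. -/
noncomputable def updateRadius (p : ℝ≥0∞ → Prop) (Ξ : Set (Site d)) (R : Site d → ℝ≥0∞)
    (ξ : Site d) : ℝ≥0∞ :=
  ⨆ (q : ℚ) (_ : p (volume (availableSites Ξ R ξ ∩ {x | edist x ξ < ratRadius q}))), ratRadius q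

theorem lt_updateRadius_iff {p : ℝ≥0∞ → Prop} {Ξ : Set (Site d)} {R : Site d → ℝ≥0∞}
    {ξ : Site d} {r : ℝ≥0∞} : r < updateRadius p Ξ R ξ ↔
      ∃ q, p (volume (availableSites Ξ R ξ ∩ {x | edist x ξ < ratRadius q})) ∧ r < ratRadius q := by
  simp [updateRadius, lt_iSup_iff]

theorem le_updateRadius {p : ℝ≥0∞ → Prop} {Ξ : Set (Site d)} {R : Site d → ℝ≥0∞}
    {ξ : Site d} {q : ℚ}
    (h : p (volume (availableSites Ξ R ξ ∩ {x | edist x ξ < ratRadius q}))) :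
    ratRadius q ≤ updateRadius p Ξ R ξ :=
  le_iSup₂_of_le q h le_rfl

theorem updateRadius_mono {p : ℝ≥0∞ → Prop} (hp : ∀ a b, a ≤ b → p b → p a) {Ξ : Set (Site d)}
    {R R' : Site d → ℝ≥0∞} (h : ∀ η ∈ Ξ, R η ≤ R' η) (ξ : Site d) :
    updateRadius p Ξ R ξ ≤ updateRadius p Ξ R' ξ :=
  iSup₂_le fun _ hq => le_updateRadius
    (hp _ _ (measure_mono (inter_subset_inter_left _ (availableSites_anti h ξ))) hq)

theorem volume_inter_le_of_lt_updateRadius {p : ℝ≥0∞ → Prop} (hp : ∀ a b, a ≤ b → p b → p a)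
    {Ξ : Set (Site d)} {R : Site d → ℝ≥0∞} {ξ : Site d} {r : ℝ≥0∞}
    (h : r < updateRadius p Ξ R ξ) : p (volume (availableSites Ξ R ξ ∩ {x | edist x ξ < r})) := by
  obtain ⟨q, hq, hr⟩ := lt_updateRadius_iff.1 h
  exact hp _ _ (measure_mono (inter_subset_inter_right _ fun x hx => lt_trans hx hr)) hq

/-- No cell exceeds the volume `α`, and centers of finite reach are sated. -/
def IsBalanced (α : ℝ≥0∞) (Ξ : Set (Site d)) (R : Site d → ℝ≥0∞) : Prop :=
  ∀ ξ ∈ Ξ, volume (cell Ξ R ξ) ≤ α ∧ (R ξ ≠ ⊤ → volume (cell Ξ R ξ) = α)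

/-- The volume available to `ξ` within distance `r` is left-continuous in `r`, and also
right-continuous because spheres are null. At a finite supremum of admissible radii it must equal
`α`. Any condition `p` between `< α` and `≤ α` serves, which covers both extremal families. -/
theorem isBalanced_of_updateRadius_eq (hd : 1 ≤ d) {α : ℝ≥0∞} {p : ℝ≥0∞ → Prop}
    (hp : ∀ a b, a ≤ b → p b → p a) (hle : ∀ a, p a → a ≤ α) (hlt : ∀ a, a < α → p a)
    {Ξ : Set (Site d)} (hΞ : Ξ.Countable) {R : Site d → ℝ≥0∞}
    (hR : ∀ ξ ∈ Ξ, updateRadius p Ξ R ξ = R ξ) : IsBalanced α Ξ R := by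
  intro ξ hξ
  have hupper : volume (cell Ξ R ξ) ≤ α := by
    have hcell : cell Ξ R ξ = ⋃ q : {q : ℚ // ratRadius q < R ξ},
        availableSites Ξ R ξ ∩ {x | edist x ξ < ratRadius q} := by
      ext x
      simp only [cell, mem_inter_iff, mem_ofPred_eq, mem_iUnion, exists_and_left]
      refine and_congr_right fun _ => ⟨fun h => ?_, fun ⟨q, hq⟩ => hq.trans q.2⟩
      obtain ⟨q, h1, h2⟩ := exists_ratRadius_btwn h
      exact ⟨⟨q, h2⟩, h1⟩
    rw [hcell, Directed.measure_iUnion]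
    · refine iSup_le fun q => hle _ (volume_inter_le_of_lt_updateRadius hp ?_)
      rw [hR ξ hξ]
      exact q.2
    · intro a b
      rcases le_total (ratRadius a) (ratRadius b) with h | h
      · exact ⟨b, inter_subset_inter_right _ fun x hx => lt_of_lt_of_le hx h, subset_rfl⟩
      · exact ⟨a, subset_rfl, inter_subset_inter_right _ fun x hx => lt_of_lt_of_le hx h⟩
  refine ⟨hupper, fun htop => le_antisymm hupper ?_⟩
  -- The null sphere is added so that the set becomes a decreasing intersection over rational radii
  -- above `R ξ`. None of these radii is admissible, so each volume is at least `α`.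
  have hnull : volume (availableSites Ξ R ξ ∩ {x | edist x ξ ≤ R ξ}) ≤ volume (cell Ξ R ξ) := by
    refine measure_mono_ae ?_
    filter_upwards [ae_edist_ne hd hΞ R] with x hx hmem
    exact ⟨hmem.1, lt_of_le_of_ne hmem.2 (hx ξ hξ)⟩
  refine le_trans ?_ hnull
  have hinter : availableSites Ξ R ξ ∩ {x | edist x ξ ≤ R ξ} =
      ⋂ q : {q : ℚ // R ξ < ratRadius q},
        availableSites Ξ R ξ ∩ {x | edist x ξ < ratRadius q} := by
    ext x
    simp only [mem_inter_iff, mem_ofPred_eq, mem_iInter]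
    constructor
    · exact fun h q => ⟨h.1, h.2.trans_lt q.2⟩
    · intro h
      obtain ⟨q₀, h₀, -⟩ := exists_ratRadius_btwn htop.lt_top
      refine ⟨(h ⟨q₀, h₀⟩).1, le_of_not_gt fun hlt' => ?_⟩
      obtain ⟨q, h1, h2⟩ := exists_ratRadius_btwn hlt'
      exact lt_asymm h2 (h ⟨q, h1⟩).2
  rw [hinter, Directed.measure_iInter]
  · refine le_iInf fun q => le_of_not_gt fun h => ?_
    have := le_updateRadius (hlt _ h)
    rw [hR ξ hξ] at this
    exact absurd q.2 (not_lt.2 this)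
  · exact fun q => ((measurableSet_availableSites hΞ R ξ).inter
      (measurableSet_setOf_edist_lt ξ _)).nullMeasurableSet
  · intro a b
    rcases le_total (ratRadius a) (ratRadius b) with h | h
    · exact ⟨a, subset_rfl, inter_subset_inter_right _ fun x hx => lt_of_lt_of_le hx h⟩
    · exact ⟨b, inter_subset_inter_right _ fun x hx => lt_of_lt_of_le hx h, subset_rfl⟩
  · obtain ⟨q, h, -⟩ := exists_ratRadius_btwn htop.lt_top
    exact ⟨⟨q, h⟩, ((measure_mono inter_subset_right).trans_lt
      (volume_setOf_edist_lt_lt_top ξ (ratRadius_ne_top q))).ne⟩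

/-- With `IsBalanced.updateRadius_le`, this places balanced radii between their `< α` update and
their `≤ α` update. By monotonicity the comparison survives every iteration from `0` and from `⊤`.
-/
theorem IsBalanced.le_updateRadius {α : ℝ≥0∞} {Ξ : Set (Site d)} {R : Site d → ℝ≥0∞}
    (h : IsBalanced α Ξ R) : ∀ ξ ∈ Ξ, R ξ ≤ updateRadius (· ≤ α) Ξ R ξ := by
  intro ξ hξ
  refine le_of_forall_lt fun r hr => ?_
  obtain ⟨q, h1, h2⟩ := exists_ratRadius_btwn hr
  refine lt_updateRadius_iff.2 ⟨q, ?_, h1⟩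
  exact (measure_mono (inter_subset_inter_right _ fun x hx => lt_trans hx h2)).trans (h ξ hξ).1

theorem IsBalanced.updateRadius_le {α : ℝ≥0∞} {Ξ : Set (Site d)} {R : Site d → ℝ≥0∞}
    (h : IsBalanced α Ξ R) : ∀ ξ ∈ Ξ, updateRadius (· < α) Ξ R ξ ≤ R ξ := by
  intro ξ hξ
  refine iSup₂_le fun q hq => le_of_not_gt fun hlt => ?_
  have := (h ξ hξ).2 hlt.ne_top
  refine absurd hq (not_lt.2 (this.symm.le.trans (measure_mono ?_)))
  exact inter_subset_inter_right _ fun x hx => lt_trans hx hlt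

/-- The radii obtained by repeated updating. -/
noncomputable def radiusSeq (p : ℝ≥0∞ → Prop) (Ξ : Set (Site d)) (r₀ : ℝ≥0∞) :
    ℕ → Site d → ℝ≥0∞
  | 0 => fun _ => r₀
  | n + 1 => updateRadius p Ξ (radiusSeq p Ξ r₀ n)

/-- The radii of the site-optimal stable allocation. -/
noncomputable def siteRadius (α : ℝ≥0∞) (Ξ : Set (Site d)) (ξ : Site d) : ℝ≥0∞ :=
  ⨅ n, radiusSeq (· ≤ α) Ξ ⊤ n ξ

/-- The radii of the center-optimal stable allocation. -/
noncomputable def centerRadius (α : ℝ≥0∞) (Ξ : Set (Site d)) (ξ : Site d) : ℝ≥0∞ :=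
  ⨆ n, radiusSeq (· < α) Ξ 0 n ξ

theorem IsBalanced.le_siteRadius {α : ℝ≥0∞} {Ξ : Set (Site d)} {R : Site d → ℝ≥0∞}
    (h : IsBalanced α Ξ R) : ∀ ξ ∈ Ξ, R ξ ≤ siteRadius α Ξ ξ := by
  have key : ∀ n, ∀ ξ ∈ Ξ, R ξ ≤ radiusSeq (· ≤ α) Ξ ⊤ n ξ := by
    intro n
    induction n with
    | zero => exact fun _ _ => le_top
    | succ n ih =>
      exact fun ξ hξ => (h.le_updateRadius ξ hξ).trans
        (updateRadius_mono (fun a b hab hb => hab.trans hb) ih ξ)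
  exact fun ξ hξ => le_iInf fun n => key n ξ hξ

theorem IsBalanced.centerRadius_le {α : ℝ≥0∞} {Ξ : Set (Site d)} {R : Site d → ℝ≥0∞}
    (h : IsBalanced α Ξ R) : ∀ ξ ∈ Ξ, centerRadius α Ξ ξ ≤ R ξ := by
  have key : ∀ n, ∀ ξ ∈ Ξ, radiusSeq (· < α) Ξ 0 n ξ ≤ R ξ := by
    intro n
    induction n with
    | zero => exact fun _ _ => zero_le
    | succ n ih =>
      exact fun ξ hξ => (updateRadius_mono (fun a b hab hb => hab.trans_lt hb) ih ξ).trans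
        (h.updateRadius_le ξ hξ)
  exact fun ξ hξ => iSup_le fun n => key n ξ hξ

theorem antitone_radiusSeq (α : ℝ≥0∞) (Ξ : Set (Site d)) :
    Antitone (radiusSeq (· ≤ α) Ξ ⊤) := by
  refine antitone_nat_of_succ_le fun n => ?_
  induction n with
  | zero => exact fun _ => le_top
  | succ n ih =>
    exact fun ξ => updateRadius_mono (fun a b hab hb => hab.trans hb)
      (fun η _ => ih η) ξ

theorem monotone_radiusSeq (α : ℝ≥0∞) (Ξ : Set (Site d)) :
    Monotone (radiusSeq (· < α) Ξ 0) := by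
  refine monotone_nat_of_le_succ fun n => ?_
  induction n with
  | zero => exact fun _ => zero_le
  | succ n ih =>
    exact fun ξ => updateRadius_mono (fun a b hab hb => hab.trans_lt hb)
      (fun η _ => ih η) ξ

/-- The update must commute with a decreasing limit of radii. Sites become available increasingly,
and `≤ α` passes to increasing limits of volumes. Local finiteness is needed for a site available in
the limit to be available at some finite stage. -/
theorem updateRadius_siteRadius (hd : 1 ≤ d) {α : ℝ≥0∞} {Ξ : Set (Site d)}
    (hΞ : IsLocallyFinite Ξ) (ξ : Site d) :
    updateRadius (· ≤ α) Ξ (siteRadius α Ξ) ξ = siteRadius α Ξ ξ := by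
  apply le_antisymm
  · refine le_iInf fun n => ?_
    cases n with
    | zero => exact le_top
    | succ n =>
      exact updateRadius_mono (fun a b hab hb => hab.trans hb) (fun η _ => iInf_le _ n) ξ
  refine le_of_forall_lt fun r hr => ?_
  obtain ⟨q, h1, h2⟩ := exists_ratRadius_btwn hr
  refine lt_updateRadius_iff.2 ⟨q, ?_, h1⟩
  have hsub : volume (availableSites Ξ (siteRadius α Ξ) ξ ∩ {x | edist x ξ < ratRadius q}) ≤
      volume (⋃ n, availableSites Ξ (radiusSeq (· ≤ α) Ξ ⊤ n) ξ ∩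
        {x | edist x ξ < ratRadius q}) := by
    refine measure_mono_ae ?_
    filter_upwards [ae_edist_ne hd hΞ.countable (siteRadius α Ξ)] with x hx hmem
    -- Only the finitely many centers no farther from `x` than `ξ` can block it. Off the null
    -- spheres, the limit radius of each such `η ≠ ξ` is strictly below its distance to `x`, hence
    -- so are the radii from some stage on.
    have hev : ∀ η ∈ {η ∈ Ξ | edist x η ≤ edist x ξ}, ∀ᶠ n in Filter.atTop,
        η ≠ ξ → ¬ edist x η < radiusSeq (· ≤ α) Ξ ⊤ n η := by
      rintro η ⟨hη, hle⟩
      by_cases hne : η = ξ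
      · simp [hne]
      have hge : siteRadius α Ξ η < edist x η :=
        lt_of_le_of_ne (le_of_not_gt fun h => absurd (hmem.1 η hη hne h) (not_lt.2 hle))
          (hx η hη).symm
      obtain ⟨N, hN⟩ := iInf_lt_iff.1 hge
      filter_upwards [Filter.eventually_ge_atTop N] with n hn _
      exact not_lt.2 ((antitone_radiusSeq α Ξ hn η).trans hN.le)
    obtain ⟨n, hn⟩ := ((hΞ.finite_setOf_edist_le x ξ).eventually_all.2 hev).exists
    refine mem_iUnion.2 ⟨n, fun η hη hne hlt => lt_of_not_ge fun hle => ?_, hmem.2⟩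
    exact hn η ⟨hη, hle⟩ hne hlt
  refine hsub.trans ?_
  rw [Monotone.measure_iUnion]
  · refine iSup_le fun n => ?_
    refine volume_inter_le_of_lt_updateRadius (p := (· ≤ α)) (fun a b hab hb => hab.trans hb) ?_
    exact h2.trans_le (iInf_le _ (n + 1))
  · exact fun m n hmn => inter_subset_inter_left _
      (availableSites_anti (fun η _ => antitone_radiusSeq α Ξ hmn η) ξ)

/-- For increasing radii the available sites decrease exactly to those of the limit, so countability
suffices. The strict condition `< α` is what an infimum of volumes passes back to a finite stage. -/
theorem updateRadius_centerRadius {α : ℝ≥0∞} {Ξ : Set (Site d)} (hΞ : Ξ.Countable)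
    (ξ : Site d) : updateRadius (· < α) Ξ (centerRadius α Ξ) ξ = centerRadius α Ξ ξ := by
  apply le_antisymm
  · refine iSup₂_le fun q hq => ?_
    have heq : availableSites Ξ (centerRadius α Ξ) ξ ∩ {x | edist x ξ < ratRadius q} =
        ⋂ n, availableSites Ξ (radiusSeq (· < α) Ξ 0 n) ξ ∩ {x | edist x ξ < ratRadius q} := by
      rw [← iInter_inter]
      congr 1
      ext x
      simp only [availableSites, mem_ofPred_eq, mem_iInter, centerRadius, lt_iSup_iff]
      exact ⟨fun h n η hη hne hlt => h η hη hne ⟨n, hlt⟩,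
        fun h η hη hne ⟨n, hlt⟩ => h n η hη hne hlt⟩
    rw [heq, Antitone.measure_iInter, iInf_lt_iff] at hq
    · obtain ⟨n, hn⟩ := hq
      exact (le_updateRadius (p := (· < α)) hn).trans
        (le_iSup (fun n => radiusSeq (· < α) Ξ 0 n ξ) (n + 1))
    · exact fun m n hmn => inter_subset_inter_left _
        (availableSites_anti (fun η _ => monotone_radiusSeq α Ξ hmn η) ξ)
    · exact fun n => ((measurableSet_availableSites hΞ _ ξ).inter
        (measurableSet_setOf_edist_lt ξ _)).nullMeasurableSet
    · exact ⟨0, ((measure_mono inter_subset_right).trans_lt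
        (volume_setOf_edist_lt_lt_top ξ (ratRadius_ne_top q))).ne⟩
  · refine iSup_le fun n => ?_
    cases n with
    | zero => exact zero_le
    | succ n =>
      exact updateRadius_mono (fun a b hab hb => hab.trans_lt hb)
        (fun η _ => le_iSup (fun n => radiusSeq (· < α) Ξ 0 n η) n) ξ

theorem isBalanced_siteRadius (hd : 1 ≤ d) (α : ℝ≥0∞) {Ξ : Set (Site d)}
    (hΞ : IsLocallyFinite Ξ) : IsBalanced α Ξ (siteRadius α Ξ) :=
  isBalanced_of_updateRadius_eq (p := (· ≤ α)) hd (fun _ _ hab hb => hab.trans hb)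
    (fun _ h => h) (fun _ h => h.le) hΞ.countable fun ξ _ => updateRadius_siteRadius hd hΞ ξ

theorem isBalanced_centerRadius (hd : 1 ≤ d) (α : ℝ≥0∞) {Ξ : Set (Site d)}
    (hΞ : Ξ.Countable) : IsBalanced α Ξ (centerRadius α Ξ) :=
  isBalanced_of_updateRadius_eq (p := (· < α)) hd (fun _ _ hab hb => hab.trans_lt hb)
    (fun _ h => h.le) (fun _ h => h) hΞ fun ξ _ => updateRadius_centerRadius hΞ ξ

end Radii

/-! ### From balanced radii to stable allocations. -/

section Allocations

variable {d : ℕ} {α : ℝ≥0∞} {Ξ : Set (Site d)} {R R' : Site d → ℝ≥0∞}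

theorem ae_ne_undefined_iff {ψ : Site d → Allot d} :
    (∀ᵐ x, ψ x ≠ .undefined) ↔ volume (ψ ⁻¹' {.undefined}) = 0 := by
  rw [ae_iff]
  simp only [not_not]
  rfl

open Classical in
/-- The allocation in which every site is claimed by the closest center within whose reach it
lies; ties are left undefined. -/
noncomputable def alloc (Ξ : Set (Site d)) (R : Site d → ℝ≥0∞) (x : Site d) : Allot d :=
  if h : ∃ ξ, ξ ∈ Ξ ∧ x ∈ cell Ξ R ξ then .center h.choose
  else if ∃ ξ ∈ Ξ, edist x ξ < R ξ then .undefined else .unclaimed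

theorem alloc_eq_center_iff {x ξ : Site d} :
    alloc Ξ R x = .center ξ ↔ ξ ∈ Ξ ∧ x ∈ cell Ξ R ξ := by
  unfold alloc
  split_ifs with h h'
  · rw [Allot.center.injEq]
    constructor
    · rintro rfl
      exact h.choose_spec
    · rintro ⟨h1, h2⟩
      exact eq_of_mem_cell h.choose_spec.1 h1 h.choose_spec.2 h2
  · simpa using fun h1 h2 => h ⟨ξ, h1, h2⟩
  · simpa using fun h1 h2 => h ⟨ξ, h1, h2⟩

theorem alloc_eq_unclaimed_iff {x : Site d} :
    alloc Ξ R x = .unclaimed ↔ ¬ ∃ ξ ∈ Ξ, edist x ξ < R ξ := by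
  unfold alloc
  split_ifs with h h'
  · obtain ⟨ξ, hξ, hx⟩ := h
    simpa using ⟨ξ, hξ, hx.2⟩
  · simpa using h'
  · simpa using h'

theorem preimage_alloc_center {ξ : Site d} (hξ : ξ ∈ Ξ) :
    alloc Ξ R ⁻¹' {.center ξ} = cell Ξ R ξ := by
  ext x
  simp [alloc_eq_center_iff, hξ]

theorem ae_alloc_ne_undefined (hΞ : IsLocallyFinite Ξ) (R : Site d → ℝ≥0∞) :
    ∀ᵐ x : Site d, alloc Ξ R x ≠ .undefined := by
  filter_upwards [ae_exists_mem_cell hΞ R] with x hx h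
  by_cases hex : ∃ ξ ∈ Ξ, edist x ξ < R ξ
  · obtain ⟨ξ, hξ, hmem⟩ := hx hex
    rw [alloc_eq_center_iff.2 ⟨hξ, hmem⟩] at h
    cases h
  · rw [alloc_eq_unclaimed_iff.2 hex] at h
    cases h

theorem measurable_allot {β : Type*} [MeasurableSpace β] {f : β → Allot d}
    (hcenter : ∀ B : Set (Site d), MeasurableSet B →
      MeasurableSet {b | ∃ ξ ∈ B, f b = .center ξ})
    (hunclaimed : MeasurableSet {b | f b = .unclaimed}) : Measurable f := by
  intro s hs
  have hundef : MeasurableSet {b | f b = .undefined} := by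
    have : {b | f b = .undefined} =
        ({b | ∃ ξ ∈ (univ : Set (Site d)), f b = .center ξ} ∪ {b | f b = .unclaimed})ᶜ := by
      ext b
      rcases h : f b <;> simp [h]
    rw [this]
    exact ((hcenter univ .univ).union hunclaimed).compl
  have hsplit : f ⁻¹' s = {b | ∃ ξ ∈ Allot.center ⁻¹' s, f b = .center ξ} ∪
      ({b | f b = .unclaimed} ∩ {_b | Allot.unclaimed ∈ s} ∪
        {b | f b = .undefined} ∩ {_b | Allot.undefined ∈ s}) := by
    ext b
    rcases h : f b <;> simp [h]
  rw [hsplit]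
  exact (hcenter _ hs).union ((hunclaimed.inter (.const _)).union (hundef.inter (.const _)))

theorem measurable_alloc (hΞ : Ξ.Countable) (R : Site d → ℝ≥0∞) : Measurable (alloc Ξ R) := by
  refine measurable_allot (fun B _ => ?_) ?_
  · have : {x | ∃ ξ ∈ B, alloc Ξ R x = .center ξ} = ⋃ ξ ∈ Ξ, {x | ξ ∈ B} ∩ cell Ξ R ξ := by
      ext x
      simp only [alloc_eq_center_iff, mem_ofPred_eq, mem_iUnion, mem_inter_iff, exists_prop]
      grind
    rw [this]
    exact .biUnion hΞ fun ξ _ => (MeasurableSet.const _).inter (measurableSet_cell hΞ R ξ)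
  · have : {x | alloc Ξ R x = .unclaimed} = (⋃ ξ ∈ Ξ, {x | edist x ξ < R ξ})ᶜ := by
      ext x
      simp only [mem_ofPred_eq, alloc_eq_unclaimed_iff, mem_compl_iff, mem_iUnion, exists_prop]
    rw [this]
    exact (MeasurableSet.biUnion hΞ fun ξ _ => measurableSet_setOf_edist_lt ξ _).compl

/-- A center that covets `x` has `x` within its radius: an unsated center has infinite radius, and
otherwise `x` is closer than some site already claimed. But then `x` cannot be unclaimed, nor
claimed by a center farther away. -/
theorem IsBalanced.isStableAllocation (hR : IsBalanced α Ξ R) (hΞ : IsLocallyFinite Ξ) :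
    IsStableAllocation α Ξ (alloc Ξ R) := by
  refine ⟨⟨measurable_alloc hΞ.countable R, fun x ξ h => (alloc_eq_center_iff.1 h).1, ?_,
    fun ξ hξ => ?_⟩, ?_⟩
  · exact ae_ne_undefined_iff.1 (ae_alloc_ne_undefined hΞ R)
  · rw [preimage_alloc_center hξ]
    exact (hR ξ hξ).1
  rintro x ξ hξ ⟨-, -, hdes, hcov⟩
  have hlt : edist x ξ < R ξ := by
    rcases hcov with ⟨x', hx', hlt⟩ | hns
    · refine lt_trans ?_ (alloc_eq_center_iff.1 hx').2.2
      rw [edist_dist, edist_dist]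
      exact (ENNReal.ofReal_lt_ofReal_iff_of_nonneg dist_nonneg).2 hlt
    · rw [IsSated, preimage_alloc_center hξ] at hns
      rw [not_not.1 (mt (hR ξ hξ).2 hns)]
      exact edist_lt_top _ _
  rcases hdes with ⟨ζ, hζ, hlt'⟩ | hun
  · by_cases hne : ξ = ζ
    · exact hlt'.ne (hne ▸ rfl)
    · have := (alloc_eq_center_iff.1 hζ).2.1 ξ hξ hne hlt
      rw [edist_dist, edist_dist, ENNReal.ofReal_lt_ofReal_iff_of_nonneg dist_nonneg] at this
      exact lt_asymm hlt' this
  · exact alloc_eq_unclaimed_iff.1 hun ⟨ξ, hξ, hlt⟩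

/-! ### From stable allocations back to balanced radii. -/

open Classical in
/-- The reach of `ξ` in an allocation: a site closer than that is coveted by `ξ`. -/
noncomputable def reach (α : ℝ≥0∞) (ψ : Site d → Allot d) (ξ : Site d) : ℝ≥0∞ :=
  if IsSated α ψ ξ then ⨆ (x : Site d) (_ : ψ x = .center ξ), edist x ξ else ⊤

theorem covets_of_edist_lt_reach {ψ : Site d → Allot d} {ξ x : Site d}
    (h : edist x ξ < reach α ψ ξ) : Covets α ψ ξ x := by
  unfold reach at h
  split_ifs at h with hs
  · simp only [lt_iSup_iff] at h
    obtain ⟨x', hx', hlt⟩ := h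
    rw [edist_dist, edist_dist, ENNReal.ofReal_lt_ofReal_iff_of_nonneg dist_nonneg] at hlt
    exact Or.inl ⟨x', hx', hlt⟩
  · exact Or.inr hs

theorem edist_le_reach {ψ : Site d → Allot d} {ξ x : Site d} (h : ψ x = .center ξ) :
    edist x ξ ≤ reach α ψ ξ := by
  unfold reach
  split_ifs
  · exact le_iSup₂_of_le x h le_rfl
  · exact le_top

theorem IsStableAllocation.reach_le_edist {ψ : Site d → Allot d}
    (h : IsStableAllocation α Ξ ψ) {x ξ : Site d} (hξ : ξ ∈ Ξ) (hx : ψ x = .unclaimed) :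
    reach α ψ ξ ≤ edist x ξ := by
  refine le_of_not_gt fun hlt => h.2 x ξ hξ ⟨?_, ?_, Or.inr hx, covets_of_edist_lt_reach hlt⟩ <;>
  simp [hx]

theorem IsStableAllocation.edist_le_edist {ψ : Site d → Allot d}
    (h : IsStableAllocation α Ξ ψ) {x ξ ζ : Site d} (hξ : ξ ∈ Ξ) (hx : ψ x = .center ζ)
    (hlt : edist x ξ < reach α ψ ξ) : edist x ζ ≤ edist x ξ := by
  by_cases hne : ζ = ξ
  · rw [hne]
  refine le_of_not_gt fun hlt' => h.2 x ξ hξ ⟨?_, ?_, Or.inl ⟨ζ, hx, ?_⟩,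
    covets_of_edist_lt_reach hlt⟩
  · simpa [hx] using hne
  · simp [hx]
  · rwa [edist_dist, edist_dist, ENNReal.ofReal_lt_ofReal_iff_of_nonneg dist_nonneg] at hlt'

/-- Stability yields only weak inequalities between distances; discarding the null spheres and
bisectors makes them strict. -/
theorem IsStableAllocation.ae_mem_cell (hd : 1 ≤ d) (hΞ : Ξ.Countable) {ψ : Site d → Allot d}
    (h : IsStableAllocation α Ξ ψ) :
    ∀ᵐ x : Site d, ∀ ξ, ψ x = .center ξ → x ∈ cell Ξ (reach α ψ) ξ := by
  filter_upwards [ae_edist_ne hd hΞ (reach α ψ), ae_edist_ne_edist hΞ] with x hx hx' ξ hξ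
  have hmem := h.1.mem_centers x ξ hξ
  exact ⟨fun η hη hne hlt => (h.edist_le_edist hη hξ hlt).lt_of_ne (hx' ξ hmem η hη hne.symm),
    (edist_le_reach hξ).lt_of_ne (hx ξ hmem)⟩

theorem IsStableAllocation.isBalanced_reach (hd : 1 ≤ d) (hΞ : Ξ.Countable)
    {ψ : Site d → Allot d} (h : IsStableAllocation α Ξ ψ) : IsBalanced α Ξ (reach α ψ) := by
  intro ξ hξ
  -- Territories lie in cells a.e. Conversely, a site of the cell of `ξ` cannot be unclaimed, being
  -- within reach, nor belong to another center, since cells are disjoint.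
  have hvol : volume (cell Ξ (reach α ψ) ξ) = volume (ψ ⁻¹' {.center ξ}) := by
    have hdef : ∀ᵐ x, ψ x ≠ .undefined := ae_ne_undefined_iff.2 h.1.undefined_null
    refine measure_congr ?_
    filter_upwards [h.ae_mem_cell hd hΞ, hdef] with x hx hx'
    refine propext ⟨fun hc => ?_, fun hψ => hx ξ hψ⟩
    change x ∈ cell Ξ (reach α ψ) ξ at hc
    change ψ x = .center ξ
    rcases hψ : ψ x with ζ | _ | _
    · rw [eq_of_mem_cell (h.1.mem_centers x ζ hψ) hξ (hx ζ hψ) hc]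
    · exact absurd (h.reach_le_edist hξ hψ) (not_le.2 hc.2)
    · exact absurd hψ hx'
  rw [hvol]
  refine ⟨h.1.territory_le ξ hξ, fun hne => ?_⟩
  by_contra hns
  exact hne (by simp [reach, IsSated, hns])

/-! ### Opposite preferences of sites and centers. -/

/-- A strictly decreasing function of the distance from `x` to its center under `ψ`. -/
noncomputable def score (x : Site d) : Allot d → ℝ≥0∞
  | .center ξ => (1 + edist x ξ)⁻¹
  | _ => 0

theorem score_le_one (x : Site d) (a : Allot d) : score x a ≤ 1 := by
  cases a <;> simp [score]

theorem inv_one_add_edist_pos (x ξ : Site d) : 0 < (1 + edist x ξ)⁻¹ := by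
  simp [edist_ne_top]

theorem inv_one_add_lt_inv_one_add {a b : ℝ≥0∞} (h : a < b) :
    (1 + b)⁻¹ < (1 + a)⁻¹ := by
  rw [ENNReal.inv_lt_inv]
  exact (ENNReal.add_lt_add_iff_left ENNReal.one_ne_top).2 h

/-- Larger radii only widen the choice of a site. The value `a` is arbitrary so that it may also
come from a stable allocation known only through its reach. -/
theorem score_le_score_of_le (hRR' : ∀ ξ ∈ Ξ, R ξ ≤ R' ξ) {x : Site d} {a : Allot d}
    (ha : ∀ ξ, a = .center ξ → ξ ∈ Ξ ∧ x ∈ cell Ξ R ξ) (hx : alloc Ξ R' x ≠ .undefined) :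
    score x a ≤ score x (alloc Ξ R' x) := by
  rcases a with ξ | _ | _
  · obtain ⟨hξ, hmem⟩ := ha ξ rfl
    have hlt := hmem.2.trans_le (hRR' ξ hξ)
    rcases hψ : alloc Ξ R' x with ζ | _ | _
    · by_cases hne : ξ = ζ
      · rw [hne]
      · have := (alloc_eq_center_iff.1 hψ).2.1 ξ hξ hne hlt
        exact (inv_one_add_lt_inv_one_add this).le
    · exact absurd ⟨ξ, hξ, hlt⟩ (alloc_eq_unclaimed_iff.1 hψ)
    · exact absurd hψ hx
  · exact zero_le
  · exact zero_le

theorem ae_score_alloc_le_score_alloc (hΞ : IsLocallyFinite Ξ) (hRR' : ∀ ξ ∈ Ξ, R ξ ≤ R' ξ) :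
    ∀ᵐ x : Site d, score x (alloc Ξ R x) ≤ score x (alloc Ξ R' x) := by
  filter_upwards [ae_alloc_ne_undefined hΞ R'] with x hx
  exact score_le_score_of_le hRR' (fun ξ h => alloc_eq_center_iff.1 h) hx

/-- If the extremal allocations give a.e. site centers at the same distance, then every stable
allocation agrees with the site-optimal one. -/
theorem IsStableAllocation.ae_eq_alloc_siteRadius (hd : 1 ≤ d) (hΞ : IsLocallyFinite Ξ)
    (hscore : ∀ᵐ x : Site d, score x (alloc Ξ (centerRadius α Ξ) x) =
      score x (alloc Ξ (siteRadius α Ξ) x))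
    {ψ : Site d → Allot d} (h : IsStableAllocation α Ξ ψ) :
    ψ =ᵐ[volume] alloc Ξ (siteRadius α Ξ) := by
  have hbal := h.isBalanced_reach hd hΞ.countable
  have hdef : ∀ᵐ x, ψ x ≠ .undefined := ae_ne_undefined_iff.2 h.1.undefined_null
  filter_upwards [hscore, h.ae_mem_cell hd hΞ.countable, hdef,
    ae_alloc_ne_undefined hΞ (siteRadius α Ξ)] with x hx hcell hxψ hxs
  have hle : score x (ψ x) ≤ score x (alloc Ξ (siteRadius α Ξ) x) :=
    score_le_score_of_le hbal.le_siteRadius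
      (fun ξ hξ => ⟨h.1.mem_centers x ξ hξ, hcell ξ hξ⟩) hxs
  -- The center-optimal score is the common extremal value. Its center at `x` also has `x` within
  -- its reach under `ψ`, so stability puts the center of `x` under `ψ` no farther away.
  have hge : score x (alloc Ξ (siteRadius α Ξ) x) ≤ score x (ψ x) := by
    rw [← hx]
    rcases hc : alloc Ξ (centerRadius α Ξ) x with ξ | _ | _
    · obtain ⟨hξ, hmem⟩ := alloc_eq_center_iff.1 hc
      have hlt := hmem.2.trans_le (hbal.centerRadius_le ξ hξ)
      rcases hψ : ψ x with ζ | _ | _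
      · exact ENNReal.inv_le_inv.2 (add_le_add_right (h.edist_le_edist hξ hψ hlt) 1)
      · exact absurd (h.reach_le_edist hξ hψ) (not_le.2 hlt)
      · exact absurd hψ hxψ
    · exact zero_le
    · exact zero_le
  have heq := le_antisymm hle hge
  rcases hs : alloc Ξ (siteRadius α Ξ) x with ζ | _ | _
  · rcases hψ : ψ x with ξ | _ | _
    · by_cases hne : ξ = ζ
      · rw [hne]
      · have hlt := (alloc_eq_center_iff.1 hs).2.1 ξ (h.1.mem_centers x ξ hψ) hne
          ((hcell ξ hψ).2.trans_le (hbal.le_siteRadius ξ (h.1.mem_centers x ξ hψ)))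
        rw [hs, hψ] at heq
        exact absurd heq (inv_one_add_lt_inv_one_add hlt).ne
    · rw [hs, hψ] at heq
      exact absurd heq (inv_one_add_edist_pos x ζ).ne
    · exact absurd hψ hxψ
  · rcases hψ : ψ x with ξ | _ | _
    · rw [hs, hψ] at heq
      exact absurd heq (inv_one_add_edist_pos x ξ).ne'
    · rfl
    · exact absurd hψ hxψ
  · exact absurd hs hxs

/-- Centers prefer smaller radii. -/
theorem setLIntegral_cell_le (hΞ : Ξ.Countable) (hα : α ≠ ⊤) (hR : IsBalanced α Ξ R)
    (hR' : IsBalanced α Ξ R') (hRR' : ∀ ξ ∈ Ξ, R ξ ≤ R' ξ) {ξ : Site d} (hξ : ξ ∈ Ξ) :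
    ∫⁻ x in cell Ξ R' ξ, (1 + edist x ξ)⁻¹ ≤ ∫⁻ x in cell Ξ R ξ, (1 + edist x ξ)⁻¹ := by
  have hav := availableSites_anti hRR' ξ
  rcases (hRR' ξ hξ).eq_or_lt with heq | hlt
  · refine lintegral_mono_set fun x hx => ⟨hav hx.1, ?_⟩
    exact lt_of_lt_of_eq hx.2 heq.symm
  have hm := measurableSet_cell hΞ R ξ
  have hm' := measurableSet_cell hΞ R' ξ
  -- Here `R ξ < R' ξ`, so `R ξ` is finite and the smaller-radius cell has the full volume `α`.
  -- Removing the common part, which has finite volume, preserves the comparison.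
  have hvol : volume (cell Ξ R' ξ \ cell Ξ R ξ) ≤ volume (cell Ξ R ξ \ cell Ξ R' ξ) := by
    have h1 := measure_inter_add_sdiff (μ := volume) (cell Ξ R ξ) hm'
    have h2 := measure_inter_add_sdiff (μ := volume) (cell Ξ R' ξ) hm
    have h3 : volume (cell Ξ R' ξ) ≤ volume (cell Ξ R ξ) := by
      rw [(hR ξ hξ).2 hlt.ne_top]
      exact (hR' ξ hξ).1
    rw [← h1, ← h2, inter_comm] at h3
    refine (ENNReal.add_le_add_iff_left ?_).1 h3
    exact ((measure_mono inter_subset_left).trans_lt ((hR ξ hξ).1.trans_lt hα.lt_top)).ne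
  rw [← lintegral_inter_add_sdiff _ (cell Ξ R' ξ) hm,
    ← lintegral_inter_add_sdiff _ (cell Ξ R ξ) hm', inter_comm]
  refine add_le_add le_rfl ?_
  -- Passing from `R'` to `R` trades sites at distance at least `R ξ` for at least as much volume of
  -- sites at distance below `R ξ`.
  calc ∫⁻ x in cell Ξ R' ξ \ cell Ξ R ξ, (1 + edist x ξ)⁻¹
      ≤ ∫⁻ _ in cell Ξ R' ξ \ cell Ξ R ξ, (1 + R ξ)⁻¹ := by
        refine setLIntegral_mono' (hm'.diff hm) fun x hx => ?_
        refine ENNReal.inv_le_inv.2 (add_le_add_right (le_of_not_gt fun h => ?_) 1)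
        exact hx.2 ⟨hav hx.1.1, h⟩
    _ ≤ ∫⁻ _ in cell Ξ R ξ \ cell Ξ R' ξ, (1 + R ξ)⁻¹ := by
        rw [setLIntegral_const, setLIntegral_const]
        gcongr
    _ ≤ ∫⁻ x in cell Ξ R ξ \ cell Ξ R' ξ, (1 + edist x ξ)⁻¹ := by
        refine setLIntegral_mono' (hm.diff hm') fun x hx => ?_
        exact ENNReal.inv_le_inv.2 (add_le_add_right hx.1.2.le 1)

/-- The value of a function at the center, and zero if there is none. -/
def atCenter (f : Site d → ℝ≥0∞) : Allot d → ℝ≥0∞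
  | .center ξ => f ξ
  | _ => 0

theorem lintegral_atCenter_mul_score (hΞ : Ξ.Countable) (f : Site d → ℝ≥0∞) :
    ∫⁻ x, atCenter f (alloc Ξ R x) * score x (alloc Ξ R x) =
      ∑' ξ : Ξ, f ξ * ∫⁻ x in cell Ξ R ξ, (1 + edist x (ξ : Site d))⁻¹ := by
  have hcount := hΞ.to_subtype
  have hsupp : ∫⁻ x, atCenter f (alloc Ξ R x) * score x (alloc Ξ R x) =
      ∫⁻ x in ⋃ ξ : Ξ, cell Ξ R ξ, atCenter f (alloc Ξ R x) * score x (alloc Ξ R x) := by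
    refine (setLIntegral_eq_of_support_subset ?_).symm
    intro x hx
    rcases hψ : alloc Ξ R x with ξ | _ | _
    · obtain ⟨hξ, hmem⟩ := alloc_eq_center_iff.1 hψ
      exact mem_iUnion.2 ⟨⟨ξ, hξ⟩, hmem⟩
    · simp [hψ, score] at hx
    · simp [hψ, score] at hx
  rw [hsupp, lintegral_iUnion (fun ξ : Ξ => measurableSet_cell hΞ R ξ)]
  · refine tsum_congr fun ξ => ?_
    rw [← lintegral_const_mul _ (by fun_prop)]
    refine setLIntegral_congr_fun (measurableSet_cell hΞ R ξ) fun x hx => ?_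
    simp only [alloc_eq_center_iff.2 ⟨ξ.2, hx⟩, atCenter, score]
  · intro ξ η hne
    exact disjoint_left.2 fun x hx hx' => hne (Subtype.ext (eq_of_mem_cell ξ.2 η.2 hx hx'))

theorem lintegral_atCenter_mul_score_le (hΞ : Ξ.Countable) (hα : α ≠ ⊤) (hR : IsBalanced α Ξ R)
    (hR' : IsBalanced α Ξ R') (hRR' : ∀ ξ ∈ Ξ, R ξ ≤ R' ξ) (f : Site d → ℝ≥0∞) :
    ∫⁻ x, atCenter f (alloc Ξ R' x) * score x (alloc Ξ R' x) ≤
      ∫⁻ x, atCenter f (alloc Ξ R x) * score x (alloc Ξ R x) := by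
  rw [lintegral_atCenter_mul_score hΞ, lintegral_atCenter_mul_score hΞ]
  refine ENNReal.tsum_le_tsum fun ξ => ?_
  refine mul_le_mul_right ?_ _
  exact setLIntegral_cell_le hΞ hα hR hR' hRR' ξ.2

end Allocations

/-! ### Equivariance of the construction. -/

section Isometries

variable {d : ℕ}

theorem volume_image_isometryEquiv (T : Site d ≃ᵢ Site d) (s : Set (Site d)) :
    volume (T '' s) = volume s := by
  -- By Mazur–Ulam, an isometry is a linear isometry followed by a translation.
  have hT : ⇑T = (fun x => x + T 0) ∘ T.toRealLinearIsometryEquiv := by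
    ext x : 1
    simp [IsometryEquiv.toRealLinearIsometryEquiv_apply]
  rw [hT, image_comp, image_add_right, measure_preimage_add_right,
    LinearIsometryEquiv.image_eq_preimage_symm]
  exact (LinearIsometryEquiv.measurePreserving _).measure_preimage_equiv
    (f := T.toRealLinearIsometryEquiv.symm.toHomeomorph.toMeasurableEquiv) s

theorem availableSites_image (T : Site d ≃ᵢ Site d) (Ξ : Set (Site d)) (R : Site d → ℝ≥0∞)
    (ξ : Site d) : availableSites (T '' Ξ) R (T ξ) = T '' availableSites Ξ (R ∘ T) ξ := by
  ext x
  obtain ⟨x, rfl⟩ := T.surjective x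
  simp [availableSites, T.isometry.edist_eq]

theorem cell_image (T : Site d ≃ᵢ Site d) (Ξ : Set (Site d)) (R : Site d → ℝ≥0∞)
    (ξ : Site d) : cell (T '' Ξ) R (T ξ) = T '' cell Ξ (R ∘ T) ξ := by
  ext x
  obtain ⟨x, rfl⟩ := T.surjective x
  simp [cell, availableSites_image, T.isometry.edist_eq]

theorem updateRadius_image (p : ℝ≥0∞ → Prop) (T : Site d ≃ᵢ Site d) (Ξ : Set (Site d))
    (R : Site d → ℝ≥0∞) (ξ : Site d) :
    updateRadius p (T '' Ξ) R (T ξ) = updateRadius p Ξ (R ∘ T) ξ := by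
  have hball (r : ℝ≥0∞) : {x | edist x (T ξ) < r} = T '' {x | edist x ξ < r} := by
    ext x
    obtain ⟨x, rfl⟩ := T.surjective x
    simp [T.isometry.edist_eq]
  simp only [updateRadius, availableSites_image, hball, ← image_inter T.injective,
    volume_image_isometryEquiv]

theorem radiusSeq_image (p : ℝ≥0∞ → Prop) (T : Site d ≃ᵢ Site d) (Ξ : Set (Site d))
    (r₀ : ℝ≥0∞) (n : ℕ) (ξ : Site d) :
    radiusSeq p (T '' Ξ) r₀ n (T ξ) = radiusSeq p Ξ r₀ n ξ := by
  induction n generalizing ξ with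
  | zero => rfl
  | succ n ih =>
    rw [radiusSeq, radiusSeq, updateRadius_image]
    congr 1
    exact funext ih

theorem siteRadius_image (α : ℝ≥0∞) (T : Site d ≃ᵢ Site d) (Ξ : Set (Site d)) :
    siteRadius α (T '' Ξ) ∘ T = siteRadius α Ξ := by
  ext ξ
  simp [siteRadius, radiusSeq_image]

theorem centerRadius_image (α : ℝ≥0∞) (T : Site d ≃ᵢ Site d) (Ξ : Set (Site d)) :
    centerRadius α (T '' Ξ) ∘ T = centerRadius α Ξ := by
  ext ξ
  simp [centerRadius, radiusSeq_image]

theorem alloc_image (T : Site d ≃ᵢ Site d) (Ξ : Set (Site d)) (R : Site d → ℝ≥0∞)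
    (x : Site d) : alloc (T '' Ξ) R (T x) = (alloc Ξ (R ∘ T) x).map T := by
  rcases h : alloc Ξ (R ∘ T) x with ξ | _ | _
  · obtain ⟨hξ, hx⟩ := alloc_eq_center_iff.1 h
    refine alloc_eq_center_iff.2 ⟨mem_image_of_mem T hξ, ?_⟩
    rw [cell_image]
    exact mem_image_of_mem T hx
  · refine alloc_eq_unclaimed_iff.2 ?_
    simpa [T.isometry.edist_eq] using alloc_eq_unclaimed_iff.1 h
  · rcases h' : alloc (T '' Ξ) R (T x) with ξ | _ | _
    · obtain ⟨ξ, rfl⟩ := T.surjective ξ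
      have := alloc_eq_center_iff.1 h'
      rw [cell_image, T.injective.mem_set_image, T.injective.mem_set_image] at this
      rw [alloc_eq_center_iff.2 this] at h
      cases h
    · rw [alloc_eq_unclaimed_iff] at h'
      have : alloc Ξ (R ∘ T) x = .unclaimed := alloc_eq_unclaimed_iff.2 (by simpa [T.isometry.edist_eq] using h')
      rw [h] at this
      cases this
    · rfl

end Isometries

/-! ### Measurability of the set of locally finite simple point measures. -/

section Configurations

variable {d : ℕ}

/-- A locally finite simple point measure. -/
def IsConfiguration (π : Measure (Site d)) : Prop :=
  IsSimplePointMeasure π ∧ IsLocallyFinite (support π)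

theorem support_count_restrict {S : Set (Site d)} (hS : S.Countable) :
    support (Measure.count.restrict S) = S := by
  ext z
  rw [support, mem_ofPred_eq, Measure.restrict_apply' hS.measurableSet]
  by_cases hz : z ∈ S
  · simp [inter_eq_left.2 (singleton_subset_iff.2 hz), hz]
  · simp [singleton_inter_eq_empty.2 hz, hz]

theorem IsSimplePointMeasure.countable_support {π : Measure (Site d)}
    (h : IsSimplePointMeasure π) : (support π).Countable := by
  obtain ⟨S, hS, rfl⟩ := h
  rwa [support_count_restrict hS]

theorem IsSimplePointMeasure.apply {π : Measure (Site d)} (h : IsSimplePointMeasure π)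
    (A : Set (Site d)) : π A = Measure.count (A ∩ support π) := by
  obtain ⟨S, hS, rfl⟩ := h
  rw [support_count_restrict hS, Measure.restrict_apply' hS.measurableSet]

theorem IsSimplePointMeasure.apply_ne_zero_iff {π : Measure (Site d)}
    (h : IsSimplePointMeasure π) {A : Set (Site d)} : π A ≠ 0 ↔ ∃ η ∈ support π, η ∈ A := by
  rw [h.apply, Ne, Measure.count_eq_zero_iff, ← Ne, ← nonempty_iff_ne_empty]
  exact ⟨fun ⟨η, h1, h2⟩ => ⟨η, h2, h1⟩, fun ⟨η, h1, h2⟩ => ⟨η, h2, h1⟩⟩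

theorem IsConfiguration.apply_closedBall_lt_top {π : Measure (Site d)} (h : IsConfiguration π)
    (x : Site d) (r : ℝ) : π (Metric.closedBall x r) < ⊤ := by
  rw [h.1.apply, inter_comm]
  exact Measure.count_apply_lt_top.2 (h.2 x r)

theorem isConfiguration_zero : IsConfiguration (0 : Measure (Site d)) :=
  ⟨⟨∅, countable_empty, by simp⟩, fun x r => by simp [support]⟩

theorem IsLocallyFinite.of_nhds {Ξ : Set (Site d)}
    (h : ∀ z : Site d, ∃ U ∈ nhds z, (Ξ ∩ U).Finite) : IsLocallyFinite Ξ := by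
  intro x r
  refine (isCompact_closedBall x r).induction_on (p := fun s => (Ξ ∩ s).Finite) (by simp)
    (fun s t hst ht => ht.subset (inter_subset_inter_right _ hst))
    (fun s t hs ht => by rw [inter_union_distrib_left]; exact hs.union ht) fun z _ => ?_
  obtain ⟨U, hU, hfin⟩ := h z
  exact ⟨U, mem_nhdsWithin_of_mem_nhds hU, hfin⟩

/-- Small balls contain at most one point, uniformly on bounded regions. -/
def HasSmallBalls (π : Measure (Site d)) : Prop :=
  ∀ K : ℕ, ∃ m : ℕ, ∀ k ≥ m, ∀ n : ℕ, ‖TopologicalSpace.denseSeq (Site d) n‖ < K →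
    π (Metric.ball (TopologicalSpace.denseSeq (Site d) n) (1 / ((k : ℝ) + 1))) ∈ ({0, 1} : Set ℝ≥0∞)

theorem measurableSet_hasSmallBalls : MeasurableSet {π : Measure (Site d) | HasSmallBalls π} := by
  have : {π : Measure (Site d) | HasSmallBalls π} =
      ⋂ K : ℕ, ⋃ m : ℕ, ⋂ k ≥ m, ⋂ n : ℕ, ⋂ (_ : ‖TopologicalSpace.denseSeq (Site d) n‖ < K),
        (fun π => π (Metric.ball (TopologicalSpace.denseSeq (Site d) n) (1 / ((k : ℝ) + 1)))) ⁻¹'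
          ({0, 1} : Set ℝ≥0∞) := by
    ext π
    simp only [HasSmallBalls, mem_ofPred_eq, mem_iInter, mem_iUnion, mem_preimage]
  rw [this]
  refine .iInter fun K => .iUnion fun m => .iInter fun k => .iInter fun _ => .iInter fun n =>
    .iInter fun _ => ?_
  exact Measure.measurable_coe measurableSet_ball ((finite_singleton _).insert _).measurableSet

/-- The finitely many points in the ball of radius `K + 1` have a positive minimal distance; once
the diameters of small balls fall below it, each holds at most one point. -/
theorem IsConfiguration.hasSmallBalls {π : Measure (Site d)} (h : IsConfiguration π) :
    HasSmallBalls π := by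
  intro K
  have hF := h.2 0 (K + 1)
  have hev : ∀ η ∈ support π ∩ Metric.closedBall 0 ((K : ℝ) + 1),
      ∀ᶠ k : ℕ in Filter.atTop, ∀ ζ ∈ support π ∩ Metric.closedBall 0 ((K : ℝ) + 1),
        η ≠ ζ → 2 * (1 / ((k : ℝ) + 1)) < dist η ζ := by
    intro η _
    refine (hF.eventually_all).2 fun ζ _ => ?_
    by_cases hne : η = ζ
    · simp [hne]
    have hlim : Filter.Tendsto (fun k : ℕ => 2 * (1 / ((k : ℝ) + 1))) Filter.atTop (nhds 0) := by
      simpa using (tendsto_one_div_add_atTop_nhds_zero_nat (𝕜 := ℝ)).const_mul 2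
    filter_upwards [hlim.eventually_lt_const (dist_pos.2 hne)] with k hk _ using hk
  obtain ⟨m, hm⟩ := Filter.eventually_atTop.1 ((hF.eventually_all).2 hev)
  refine ⟨m, fun k hk n hn => ?_⟩
  set q := TopologicalSpace.denseSeq (Site d) n
  have hk1 : 1 / ((k : ℝ) + 1) ≤ 1 := by
    rw [div_le_one (by positivity)]
    linarith [(Nat.cast_nonneg k : (0 : ℝ) ≤ k)]
  have hin : ∀ η ∈ Metric.ball q (1 / ((k : ℝ) + 1)),
      η ∈ Metric.closedBall (0 : Site d) ((K : ℝ) + 1) := by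
    intro η hη
    rw [Metric.mem_ball] at hη
    rw [Metric.mem_closedBall]
    have := dist_triangle η q 0
    rw [dist_zero_right q] at this
    linarith
  have hsub : (Metric.ball q (1 / ((k : ℝ) + 1)) ∩ support π).Subsingleton := by
    rintro η ⟨hη, hη'⟩ ζ ⟨hζ, hζ'⟩
    by_contra hne
    have h1 := hm k hk η ⟨hη', hin η hη⟩ ζ ⟨hζ', hin ζ hζ⟩ hne
    have h2 := dist_triangle_right η ζ q
    rw [Metric.mem_ball] at hη hζ
    linarith
  rw [h.1.apply]
  rcases hsub.eq_empty_or_singleton with h0 | ⟨z, h1⟩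
  · exact Or.inl (by rw [h0, measure_empty])
  · exact Or.inr (by rw [h1, Measure.count_singleton]; rfl)

theorem HasSmallBalls.exists_ball {π : Measure (Site d)} (h : HasSmallBalls π) (z : Site d) :
    ∃ m : ℕ, ∀ k ≥ m, ∃ q : Site d, z ∈ Metric.ball q (1 / ((k : ℝ) + 1)) ∧
      π (Metric.ball q (1 / ((k : ℝ) + 1))) ∈ ({0, 1} : Set ℝ≥0∞) := by
  obtain ⟨K, hK⟩ := exists_nat_gt (‖z‖ + 1)
  obtain ⟨m, hm⟩ := h K
  refine ⟨m, fun k hk => ?_⟩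
  have hk1 : 1 / ((k : ℝ) + 1) ≤ 1 := by
    rw [div_le_one (by positivity)]
    linarith [(Nat.cast_nonneg k : (0 : ℝ) ≤ k)]
  obtain ⟨n, hn⟩ := (TopologicalSpace.denseRange_denseSeq (Site d)).exists_dist_lt z
    (show 0 < 1 / ((k : ℝ) + 1) by positivity)
  refine ⟨_, hn, hm k hk n ?_⟩
  have := dist_triangle_left (TopologicalSpace.denseSeq (Site d) n) 0 z
  rw [dist_zero_right, dist_zero_right] at this
  linarith

/-- If every neighbourhood of `z` had positive mass, balls of mass one would shrink to `z`, and
continuity from above would make `z` an atom of mass one. -/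
theorem HasSmallBalls.exists_null_nhds {π : Measure (Site d)} (h : HasSmallBalls π) {z : Site d}
    (hz : z ∉ support π) : ∃ U ∈ nhds z, π U = 0 := by
  obtain ⟨m, hm⟩ := h.exists_ball z
  by_contra! hcon
  have hone : ∀ k ≥ m, ∃ q : Site d, z ∈ Metric.ball q (1 / ((k : ℝ) + 1)) ∧
      π (Metric.ball q (1 / ((k : ℝ) + 1))) = 1 := by
    intro k hk
    obtain ⟨q, hq, hπ⟩ := hm k hk
    exact ⟨q, hq, hπ.resolve_left (hcon _ (Metric.isOpen_ball.mem_nhds hq))⟩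
  refine hz (le_antisymm ?_ ?_)
  · obtain ⟨q, hq, hπ⟩ := hone m le_rfl
    exact (measure_mono (singleton_subset_iff.2 hq)).trans hπ.le
  have hlim : Filter.Tendsto (fun j : ℕ => 2 * (1 / (((j + m : ℕ) : ℝ) + 1))) Filter.atTop
      (nhds 0) := by
    simpa using ((tendsto_one_div_add_atTop_nhds_zero_nat (𝕜 := ℝ)).comp
      (Filter.tendsto_add_atTop_nat m)).const_mul 2
  have hinter : ({z} : Set (Site d)) =
      ⋂ j : ℕ, Metric.ball z (2 * (1 / (((j + m : ℕ) : ℝ) + 1))) := by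
    ext y
    simp only [mem_singleton_iff, mem_iInter]
    constructor
    · rintro rfl j
      exact Metric.mem_ball_self (by positivity)
    · intro hy
      have : dist y z ≤ 0 := ge_of_tendsto' hlim fun j => (Metric.mem_ball.1 (hy j)).le
      exact dist_le_zero.1 this
  rw [hinter, Antitone.measure_iInter]
  · refine le_iInf fun j => ?_
    obtain ⟨q, hq, hπ⟩ := hone (j + m) (Nat.le_add_left _ _)
    rw [← hπ]
    refine measure_mono (Metric.ball_subset_ball' ?_)
    rw [Metric.mem_ball, dist_comm] at hq
    linarith
  · intro i j hij
    refine Metric.ball_subset_ball ?_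
    gcongr
  · exact fun j => measurableSet_ball.nullMeasurableSet
  · obtain ⟨q, hq, hπ⟩ := hone m le_rfl
    obtain ⟨ε, hε, hsub⟩ := Metric.isOpen_ball.mem_nhds hq |> Metric.mem_nhds_iff.1
    obtain ⟨j, hj⟩ := (hlim.eventually_lt_const hε).exists
    refine ⟨j, ne_top_of_le_ne_top ENNReal.one_ne_top ?_⟩
    exact (measure_mono ((Metric.ball_subset_ball hj.le).trans hsub)).trans hπ.le

theorem HasSmallBalls.isLocallyFinite {π : Measure (Site d)} (h : HasSmallBalls π) :
    IsLocallyFinite (support π) := by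
  refine .of_nhds fun z => ?_
  obtain ⟨m, hm⟩ := h.exists_ball z
  obtain ⟨q, hq, hπ⟩ := hm m le_rfl
  refine ⟨_, Metric.isOpen_ball.mem_nhds hq, Set.Subsingleton.finite ?_⟩
  rintro x ⟨hx, hxB⟩ y ⟨hy, hyB⟩
  by_contra hne
  have h2 : π ({x} ∪ {y}) = 1 + 1 := by
    rw [measure_union (by simpa using hne) (measurableSet_singleton y)]
    exact congrArg₂ _ hx hy
  have hle : π ({x} ∪ {y}) ≤ 1 := by
    refine (measure_mono (union_subset (singleton_subset_iff.2 hxB)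
      (singleton_subset_iff.2 hyB))).trans ?_
    rcases hπ with h0 | h1
    · exact h0.le.trans zero_le_one
    · exact h1.le
  rw [h2] at hle
  norm_num at hle

theorem HasSmallBalls.isConfiguration {π : Measure (Site d)} (h : HasSmallBalls π) :
    IsConfiguration π := by
  have hlf := h.isLocallyFinite
  refine ⟨⟨support π, hlf.countable, ?_⟩, hlf⟩
  have hnull : π (support π)ᶜ = 0 := by
    refine measure_null_of_locally_null _ fun z hz => ?_
    obtain ⟨U, hU, h0⟩ := h.exists_null_nhds hz
    exact ⟨U, mem_nhdsWithin_of_mem_nhds hU, h0⟩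
  ext A hA
  rw [Measure.restrict_apply hA, ← measure_inter_add_sdiff A hlf.countable.measurableSet,
    measure_mono_null (t := (support π)ᶜ) (s := A \ support π) (fun x hx => hx.2) hnull, add_zero]
  have hc : (A ∩ support π).Countable := hlf.countable.mono inter_subset_right
  have hsum (μ : Measure (Site d)) : μ (A ∩ support π) = ∑' z : ↥(A ∩ support π), μ {(z : Site d)} := by
    have := measure_biUnion (μ := μ) (f := fun z : Site d => {z}) hc
      (fun x _ y _ hne => by simpa using hne) (fun _ _ => measurableSet_singleton _)
    rwa [biUnion_of_singleton] at this
  rw [hsum π, hsum Measure.count]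
  refine tsum_congr fun z => ?_
  rw [Measure.count_singleton]
  exact z.2.2

/-- Replaces a condition on the atoms by one on the masses of countably many balls, which is
measurable by construction. -/
theorem isConfiguration_iff_hasSmallBalls {π : Measure (Site d)} :
    IsConfiguration π ↔ HasSmallBalls π :=
  ⟨fun h => h.hasSmallBalls, fun h => h.isConfiguration⟩

theorem measurableSet_isConfiguration :
    MeasurableSet {π : Measure (Site d) | IsConfiguration π} := by
  simp only [isConfiguration_iff_hasSmallBalls]
  exact measurableSet_hasSmallBalls

theorem support_map (π : Measure (Site d)) (T : Site d ≃ᵢ Site d) :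
    support (π.map T) = T '' support π := by
  ext z
  obtain ⟨z, rfl⟩ := T.surjective z
  rw [T.injective.mem_set_image, support, support, mem_ofPred_eq, mem_ofPred_eq,
    Measure.map_apply T.continuous.measurable (measurableSet_singleton _)]
  have : T ⁻¹' {T z} = {z} := by ext; simp
  rw [this]

theorem IsConfiguration.map {π : Measure (Site d)} (h : IsConfiguration π)
    (T : Site d ≃ᵢ Site d) : IsConfiguration (π.map T) := by
  refine ⟨⟨T '' support π, h.1.countable_support.image T, ?_⟩, ?_⟩
  · ext A hA
    rw [Measure.map_apply T.continuous.measurable hA, Measure.restrict_apply hA, h.1.apply,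
      ← Measure.count_injective_image T.injective, image_preimage_inter]
  · intro x r
    rw [support_map]
    refine ((h.2 (T.symm x) r).image T).subset ?_
    rintro _ ⟨⟨z, hz, rfl⟩, hzx⟩
    refine ⟨z, ⟨hz, ?_⟩, rfl⟩
    rwa [Metric.mem_closedBall, ← T.dist_eq, T.apply_symm_apply]

theorem isConfiguration_map_iff {π : Measure (Site d)} (T : Site d ≃ᵢ Site d) :
    IsConfiguration (π.map T) ↔ IsConfiguration π := by
  refine ⟨fun h => ?_, fun h => h.map T⟩
  have := h.map T.symm
  rwa [Measure.map_map T.symm.continuous.measurable T.continuous.measurable, T.symm_comp_self,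
    Measure.map_id] at this

end Configurations

/-! ### Joint measurability in the configuration and the site. -/

section Measurability

variable {d : ℕ} {β : Type*} [MeasurableSpace β] {π : β → Measure (Site d)}

/-- A simple point measure charges a set exactly when it has a point there, so the quantifier over
random points becomes positivity of the mass of a section. Restricting to balls gives finite
kernels, for which section masses are measurable. -/
theorem measurableSet_exists_mem_support (hπ : Measurable π) (hc : ∀ b, IsConfiguration (π b))
    {E : Set (β × Site d)} (hE : MeasurableSet E) :
    MeasurableSet {b | ∃ η ∈ support (π b), (b, η) ∈ E} := by
  have heq : {b | ∃ η ∈ support (π b), (b, η) ∈ E} =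
      ⋃ n : ℕ, {b | (π b).restrict (Metric.closedBall 0 n) (Prod.mk b ⁻¹' E) ≠ 0} := by
    ext b
    simp only [mem_ofPred_eq, mem_iUnion, Measure.restrict_apply (measurable_prodMk_left hE),
      (hc b).1.apply_ne_zero_iff]
    constructor
    · rintro ⟨η, hη, hE⟩
      obtain ⟨n, hn⟩ := exists_nat_ge (dist η 0)
      exact ⟨n, η, hη, hE, hn⟩
    · rintro ⟨n, η, hη, hE, -⟩
      exact ⟨η, hη, hE⟩
  rw [heq]
  refine .iUnion fun n => ?_
  let κ : ProbabilityTheory.Kernel β (Site d) :=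
    ⟨fun b => (π b).restrict (Metric.closedBall 0 n), by
      refine Measure.measurable_of_measurable_coe _ fun s hs => ?_
      simp only [Measure.restrict_apply hs]
      exact (Measure.measurable_coe (hs.inter Metric.isClosed_closedBall.measurableSet)).comp hπ⟩
  have hκ : Measurable fun b => κ b (Prod.mk b ⁻¹' E) :=
    ProbabilityTheory.Kernel.measurable_kernel_prodMk_left_of_finite hE fun b =>
      ⟨by
        change (π b).restrict (Metric.closedBall 0 n) univ < ⊤
        rw [Measure.restrict_apply_univ]
        exact (hc b).apply_closedBall_lt_top 0 n⟩
  exact hκ (measurableSet_singleton 0).compl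

theorem measurableSet_mem_availableSites (hπ : Measurable π) (hc : ∀ b, IsConfiguration (π b))
    {R : β → Site d → ℝ≥0∞} (hR : Measurable fun q : β × Site d => R q.1 q.2)
    {x ξ : β → Site d} (hx : Measurable x) (hξ : Measurable ξ) :
    MeasurableSet {b | x b ∈ availableSites (support (π b)) (R b) (ξ b)} := by
  have hne : MeasurableSet {q : β × Site d | q.2 ≠ ξ q.1} :=
    (measurableSet_eq_fun measurable_snd (hξ.comp measurable_fst)).compl
  have hlt : MeasurableSet {q : β × Site d | edist (x q.1) q.2 < R q.1 q.2} :=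
    measurableSet_lt (by fun_prop) hR
  have hle : MeasurableSet {q : β × Site d | edist (x q.1) q.2 ≤ edist (x q.1) (ξ q.1)} :=
    measurableSet_le (by fun_prop) (by fun_prop)
  convert (measurableSet_exists_mem_support hπ hc (hne.inter (hlt.inter hle))).compl using 1
  ext b
  simp [availableSites]

theorem measurable_updateRadius (hπ : Measurable π) (hc : ∀ b, IsConfiguration (π b))
    {p : ℝ≥0∞ → Prop} (hp : MeasurableSet {a | p a}) {R : β → Site d → ℝ≥0∞}
    (hR : Measurable fun q : β × Site d => R q.1 q.2) :
    Measurable fun q : β × Site d => updateRadius p (support (π q.1)) (R q.1) q.2 := by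
  refine .iSup fun r => ?_
  have hset : MeasurableSet {t : (β × Site d) × Site d |
      t.2 ∈ availableSites (support (π t.1.1)) (R t.1.1) t.1.2 ∩
        {x | edist x t.1.2 < ratRadius r}} := by
    exact (measurableSet_mem_availableSites (hπ.comp (measurable_fst.comp measurable_fst))
      (fun t => hc t.1.1) (R := fun t => R t.1.1)
      (hR.comp (by fun_prop : Measurable fun u : ((β × Site d) × Site d) × Site d =>
        (u.1.1.1, u.2))) measurable_snd (measurable_snd.comp measurable_fst)).inter
      (measurableSet_lt (by fun_prop) measurable_const)
  have hvol := measurable_measure_prodMk_left (ν := (volume : Measure (Site d))) hset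
  have hite : (fun q : β × Site d => ⨆ (_ : p (volume (availableSites (support (π q.1)) (R q.1) q.2 ∩
      {x | edist x q.2 < ratRadius r}))), ratRadius r) =
      indicator {q : β × Site d | p (volume (availableSites (support (π q.1)) (R q.1) q.2 ∩
        {x | edist x q.2 < ratRadius r}))} fun _ => ratRadius r := by
    ext q
    by_cases h : p (volume (availableSites (support (π q.1)) (R q.1) q.2 ∩
        {x | edist x q.2 < ratRadius r})) <;> simp [h]
  rw [hite]
  exact measurable_const.indicator (hvol hp)

theorem measurable_radiusSeq (hπ : Measurable π) (hc : ∀ b, IsConfiguration (π b))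
    {p : ℝ≥0∞ → Prop} (hp : MeasurableSet {a | p a}) (r₀ : ℝ≥0∞) (n : ℕ) :
    Measurable fun q : β × Site d => radiusSeq p (support (π q.1)) r₀ n q.2 := by
  induction n with
  | zero => exact measurable_const
  | succ n ih =>
    exact measurable_updateRadius hπ hc hp
      (R := fun b => radiusSeq p (support (π b)) r₀ n) ih

theorem measurable_siteRadius (hπ : Measurable π) (hc : ∀ b, IsConfiguration (π b))
    (α : ℝ≥0∞) : Measurable fun q : β × Site d => siteRadius α (support (π q.1)) q.2 :=
  .iInf fun n => measurable_radiusSeq hπ hc measurableSet_Iic ⊤ n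

theorem measurable_centerRadius (hπ : Measurable π) (hc : ∀ b, IsConfiguration (π b))
    (α : ℝ≥0∞) : Measurable fun q : β × Site d => centerRadius α (support (π q.1)) q.2 :=
  .iSup fun n => measurable_radiusSeq hπ hc measurableSet_Iio 0 n

theorem measurable_alloc_support (hπ : Measurable π) (hc : ∀ b, IsConfiguration (π b))
    {R : β → Site d → ℝ≥0∞} (hR : Measurable fun q : β × Site d => R q.1 q.2) :
    Measurable fun q : β × Site d => alloc (support (π q.1)) (R q.1) q.2 := by
  have hlt : MeasurableSet {u : (β × Site d) × Site d | edist u.1.2 u.2 < R u.1.1 u.2} := by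
    refine measurableSet_lt (by fun_prop) ?_
    exact hR.comp (by fun_prop : Measurable fun u : (β × Site d) × Site d => (u.1.1, u.2))
  refine measurable_allot (fun B hB => ?_) ?_
  · simp only [alloc_eq_center_iff]
    have hset : MeasurableSet {u : (β × Site d) × Site d |
        u.1.2 ∈ availableSites (support (π u.1.1)) (R u.1.1) u.2} := by
      exact measurableSet_mem_availableSites (hπ.comp (measurable_fst.comp measurable_fst))
        (fun t => hc t.1.1) (R := fun t => R t.1.1)
        (hR.comp (by fun_prop : Measurable fun u : ((β × Site d) × Site d) × Site d =>
          (u.1.1.1, u.2))) (measurable_snd.comp measurable_fst) measurable_snd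
    have := measurableSet_exists_mem_support (π := fun q : β × Site d => π q.1) (by fun_prop)
      (fun q => hc q.1) ((measurable_snd hB).inter (hset.inter hlt))
    convert this using 1
    ext q
    simp only [mem_ofPred_eq, mem_inter_iff, mem_preimage, cell]
    grind
  · simp only [alloc_eq_unclaimed_iff]
    exact (measurableSet_exists_mem_support (π := fun q : β × Site d => π q.1) (by fun_prop)
      (fun q => hc q.1) hlt).compl

end Measurability

/-! ### The mass transport principle. -/

section MassTransport

variable {d : ℕ} {Ω : Type*} [MeasurableSpace Ω]

/-- The center of an allocation value, if there is one. -/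
noncomputable def Allot.centerOrZero : Allot d → Site d
  | .center ξ => ξ
  | _ => 0

theorem Allot.measurable_centerOrZero : Measurable (Allot.centerOrZero : Allot d → Site d) :=
  fun _ hB => hB

/-- The indicator of having a center. -/
noncomputable def Allot.claimed : Allot d → ℝ≥0∞
  | .center _ => 1
  | _ => 0

theorem Allot.measurable_claimed : Measurable (Allot.claimed : Allot d → ℝ≥0∞) :=
  fun B _ => show MeasurableSet (Allot.center ⁻¹' (Allot.claimed ⁻¹' B)) from
    MeasurableSet.const (1 ∈ B)

theorem score_eq (x : Site d) (a : Allot d) :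
    score x a = a.claimed * (1 + edist x a.centerOrZero)⁻¹ := by
  cases a <;> simp [score, Allot.claimed, Allot.centerOrZero]

theorem atCenter_eq (f : Site d → ℝ≥0∞) (a : Allot d) :
    atCenter f a = a.claimed * f a.centerOrZero := by
  cases a <;> simp [atCenter, Allot.claimed, Allot.centerOrZero]

theorem measurable_score {β : Type*} [MeasurableSpace β] {x : β → Site d} {a : β → Allot d}
    (hx : Measurable x) (ha : Measurable a) : Measurable fun b => score (x b) (a b) := by
  simp only [score_eq]
  have h1 := Allot.measurable_claimed.comp ha
  have h2 := Allot.measurable_centerOrZero.comp ha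
  exact h1.mul (measurable_const.add (hx.edist h2)).inv

theorem measurable_atCenter {β : Type*} [MeasurableSpace β] {f : β → Site d → ℝ≥0∞}
    {a : β → Allot d} (hf : Measurable fun q : β × Site d => f q.1 q.2) (ha : Measurable a) :
    Measurable fun b => atCenter (f b) (a b) := by
  simp only [atCenter_eq]
  exact (Allot.measurable_claimed.comp ha).mul
    (hf.comp (measurable_id.prodMk (Allot.measurable_centerOrZero.comp ha)))

theorem score_map_addRight (v x : Site d) (a : Allot d) :
    score (x + v) (a.map (IsometryEquiv.addRight v)) = score x a := by
  cases a <;> simp [score, Allot.map]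

theorem atCenter_map_addRight (v : Site d) (f : Site d → ℝ≥0∞) (a : Allot d) :
    atCenter (fun ξ => f (ξ - v)) (a.map (IsometryEquiv.addRight v)) = atCenter f a := by
  cases a <;> simp [atCenter, Allot.map]

theorem IsTranslationInvariant.lintegral_map {P : Measure Ω} {X : Ω → Measure (Site d)}
    (hinv : IsTranslationInvariant P X) (hX : Measurable X) {F : Measure (Site d) → ℝ≥0∞}
    (hF : Measurable F) (v : Site d) :
    ∫⁻ ω, F ((X ω).map (IsometryEquiv.addRight v)) ∂P = ∫⁻ ω, F (X ω) ∂P := by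
  rw [← MeasureTheory.lintegral_map hF hX, ← hinv v, MeasureTheory.lintegral_map hF]
  exact (Measure.measurable_map _ (IsometryEquiv.continuous _).measurable).comp hX

/-- Mass transport: for a translation-covariant allocation, weighting a function of the
distance at the site or at its center gives the same mean. -/
theorem lintegral_mul_score_eq {P : Measure Ω} [SFinite P] {X : Ω → Measure (Site d)}
    (hX : Measurable X) (hinv : IsTranslationInvariant P X)
    {A : Measure (Site d) → Site d → Allot d}
    (hA : Measurable fun q : Measure (Site d) × Site d => A q.1 q.2)
    (hcov : ∀ π v x, A (π.map (IsometryEquiv.addRight v)) (x + v) =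
      (A π x).map (IsometryEquiv.addRight v))
    {h : Site d → ℝ≥0∞} (hh : Measurable h) (h0 : ∫⁻ x, h x ≠ 0) (htop : ∫⁻ x, h x ≠ ⊤) :
    ∫⁻ ω, (∫⁻ x, h x * score x (A (X ω) x)) ∂P =
      ∫⁻ ω, (∫⁻ x, atCenter h (A (X ω) x) * score x (A (X ω) x)) ∂P := by
  have hAX : Measurable fun q : Ω × Site d => A (X q.1) q.2 :=
    hA.comp ((hX.comp measurable_fst).prodMk measurable_snd)
  have hS : Measurable fun q : Ω × Site d => score q.2 (A (X q.1) q.2) :=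
    measurable_score measurable_snd hAX
  have hC : Measurable fun q : Ω × Site d => atCenter h (A (X q.1) q.2) :=
    measurable_atCenter (f := fun _ => h) (hh.comp measurable_snd) hAX
  -- shifted weights at the center, jointly measurable in the shift
  have hG : Measurable fun q : (Measure (Site d) × Site d) × Site d =>
      h q.1.2 * (atCenter (fun ξ => h (ξ - q.2)) (A q.1.1 q.1.2) * score q.1.2 (A q.1.1 q.1.2)) := by
    have h1 := hA.comp (measurable_fst : Measurable fun q : (Measure (Site d) × Site d) × Site d => q.1)
    refine (hh.comp (by fun_prop)).mul ((measurable_atCenter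
      (f := fun (q : (Measure (Site d) × Site d) × Site d) ξ => h (ξ - q.2))
      (hh.comp (by fun_prop)) h1).mul (measurable_score (by fun_prop) h1))
  -- The extra factor `∫ h` is written as an integral over a shift `v`: of `h (ξ - v)` at the center
  -- on one side, of `h (y + v)` at the site on the other.
  refine (ENNReal.mul_right_inj h0 htop).1 ?_
  have hshift (a : Allot d) : ∫⁻ v, atCenter (fun ξ => h (ξ - v)) a = (∫⁻ x, h x) * a.claimed := by
    rcases a with ξ | _ | _
    · simpa [atCenter, Allot.claimed] using lintegral_sub_left_eq_self h ξ
    · simp [atCenter, Allot.claimed]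
    · simp [atCenter, Allot.claimed]
  have hclaimed (x : Site d) (a : Allot d) : a.claimed * score x a = score x a := by
    cases a <;> simp [score, Allot.claimed]
  have hGX : Measurable fun q : (Ω × Site d) × Site d => h q.1.2 *
      (atCenter (fun ξ => h (ξ - q.2)) (A (X q.1.1) q.1.2) * score q.1.2 (A (X q.1.1) q.1.2)) :=
    hG.comp (((hX.comp (measurable_fst.comp measurable_fst)).prodMk
      (measurable_snd.comp measurable_fst)).prodMk measurable_snd)
  calc (∫⁻ x, h x) * ∫⁻ ω, (∫⁻ x, h x * score x (A (X ω) x)) ∂P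
      = ∫⁻ ω, (∫⁻ x, ∫⁻ v, h x * (atCenter (fun ξ => h (ξ - v)) (A (X ω) x) *
          score x (A (X ω) x))) ∂P := by
        rw [← lintegral_const_mul' _ _ htop]
        refine lintegral_congr fun ω => ?_
        rw [← lintegral_const_mul' _ _ htop]
        refine lintegral_congr fun x => ?_
        have hmeas : Measurable fun v : Site d => atCenter (fun ξ => h (ξ - v)) (A (X ω) x) :=
          measurable_atCenter (f := fun v ξ => h (ξ - v)) (hh.comp (by fun_prop)) measurable_const
        rw [lintegral_const_mul _ (hmeas.mul_const _), lintegral_mul_const _ hmeas, hshift,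
          mul_assoc, hclaimed, mul_left_comm]
    _ = ∫⁻ ω, (∫⁻ v, ∫⁻ x, h x * (atCenter (fun ξ => h (ξ - v)) (A (X ω) x) *
          score x (A (X ω) x))) ∂P := by
        refine lintegral_congr fun ω => lintegral_lintegral_swap (Measurable.aemeasurable ?_)
        exact hGX.comp (by fun_prop : Measurable fun q : Site d × Site d => ((ω, q.1), q.2))
    _ = ∫⁻ v, ∫⁻ ω, (∫⁻ x, h x * (atCenter (fun ξ => h (ξ - v)) (A (X ω) x) *
          score x (A (X ω) x))) ∂P := by
        refine lintegral_lintegral_swap (Measurable.aemeasurable ?_)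
        exact Measurable.lintegral_prod_right' (f := fun q : (Ω × Site d) × Site d =>
          h q.2 * (atCenter (fun ξ => h (ξ - q.1.2)) (A (X q.1.1) q.2) *
            score q.2 (A (X q.1.1) q.2))) (hGX.comp (by fun_prop :
              Measurable fun q : (Ω × Site d) × Site d => ((q.1.1, q.2), q.1.2)))
    -- Translating the configuration by `v` and substituting `x = y + v` moves the shift from the
    -- weight at the center to the weight at the site.
    _ = ∫⁻ v, ∫⁻ ω, (∫⁻ y, h (y + v) * (atCenter h (A (X ω) y) * score y (A (X ω) y))) ∂P := by
        refine lintegral_congr fun v => ?_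
        have hF : Measurable fun π : Measure (Site d) => ∫⁻ x, h x *
            (atCenter (fun ξ => h (ξ - v)) (A π x) * score x (A π x)) :=
          Measurable.lintegral_prod_right' (f := fun q : Measure (Site d) × Site d =>
            h q.2 * (atCenter (fun ξ => h (ξ - v)) (A q.1 q.2) * score q.2 (A q.1 q.2)))
            (hG.comp (by fun_prop : Measurable fun q : Measure (Site d) × Site d => (q, v)))
        rw [← hinv.lintegral_map hX hF v]
        refine lintegral_congr fun ω => ?_
        rw [← lintegral_add_right_eq_self _ v]
        refine lintegral_congr fun y => ?_
        rw [hcov, score_map_addRight, atCenter_map_addRight]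
    _ = ∫⁻ ω, (∫⁻ v, ∫⁻ y, h (y + v) * (atCenter h (A (X ω) y) * score y (A (X ω) y))) ∂P := by
        refine lintegral_lintegral_swap (Measurable.aemeasurable ?_)
        refine Measurable.lintegral_prod_right' (f := fun q : (Site d × Ω) × Site d =>
          h (q.2 + q.1.1) * (atCenter h (A (X q.1.2) q.2) * score q.2 (A (X q.1.2) q.2))) ?_
        have hm : Measurable fun q : (Site d × Ω) × Site d => (q.1.2, q.2) := by fun_prop
        exact (hh.comp (by fun_prop)).mul ((hC.comp hm).mul (hS.comp hm))
    _ = ∫⁻ ω, (∫⁻ y, ∫⁻ v, h (y + v) * (atCenter h (A (X ω) y) * score y (A (X ω) y))) ∂P := by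
        refine lintegral_congr fun ω => lintegral_lintegral_swap (Measurable.aemeasurable ?_)
        have hm : Measurable fun q : Site d × Site d => (ω, q.2) := by fun_prop
        exact (hh.comp (by fun_prop)).mul ((hC.comp hm).mul (hS.comp hm))
    _ = (∫⁻ x, h x) * ∫⁻ ω, (∫⁻ x, atCenter h (A (X ω) x) * score x (A (X ω) x)) ∂P := by
        rw [← lintegral_const_mul' _ _ htop]
        refine lintegral_congr fun ω => ?_
        rw [← lintegral_const_mul' _ _ htop]
        refine lintegral_congr fun y => ?_
        have hm : Measurable fun v => h (y + v) := hh.comp (by fun_prop)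
        rw [lintegral_mul_const _ hm, lintegral_add_left_eq_self h y]

end MassTransport

/-! ### Stationary point processes. -/

section PointProcesses

variable {d : ℕ} {Ω : Type*} [MeasurableSpace Ω] {P : Measure Ω} {X : Ω → Measure (Site d)}

open Classical in
/-- The measure itself if it is a configuration, and the empty configuration otherwise. -/
noncomputable def toConfiguration (π : Measure (Site d)) : Measure (Site d) :=
  if IsConfiguration π then π else 0

theorem isConfiguration_toConfiguration (π : Measure (Site d)) :
    IsConfiguration (toConfiguration π) := by
  unfold toConfiguration
  split_ifs with h
  · exact h
  · exact isConfiguration_zero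

theorem toConfiguration_eq {π : Measure (Site d)} (h : IsConfiguration π) :
    toConfiguration π = π := if_pos h

theorem measurable_toConfiguration : Measurable (toConfiguration (d := d)) :=
  Measurable.ite measurableSet_isConfiguration measurable_id measurable_const

theorem toConfiguration_map (π : Measure (Site d)) (T : Site d ≃ᵢ Site d) :
    toConfiguration (π.map T) = (toConfiguration π).map T := by
  by_cases h : IsConfiguration π
  · rw [toConfiguration_eq h, toConfiguration_eq (h.map T)]
  · rw [toConfiguration, toConfiguration, if_neg h, if_neg (mt (isConfiguration_map_iff T).1 h),
      Measure.map_zero]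

/-- Each translate of the unit cube has finite mean mass, so almost surely countably many translates
along a dense sequence all have finite mass. Their interiors cover the space. -/
theorem ae_isConfiguration (hX : IsSimplePointProcess P X) (hinv : IsTranslationInvariant P X)
    (hint : intensity P X < ⊤) : ∀ᵐ ω ∂P, IsConfiguration (X ω) := by
  set Q : Set (Site d) := {x | ∀ i, x i ∈ Ico (0 : ℝ) 1} with hQ
  have hQm : MeasurableSet Q := by
    have : Q = ⋂ i, (fun x : Site d => x i) ⁻¹' Ico 0 1 := by ext; simp [hQ]
    rw [this]
    exact .iInter fun i => measurableSet_Ico.preimage (by fun_prop)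
  obtain ⟨c, hc⟩ : ∃ c : Site d, Q ∈ nhds c := by
    refine ⟨WithLp.toLp 2 fun _ => 1 / 2, ?_⟩
    have : Q = ⋂ i, (fun x : Site d => x i) ⁻¹' Ico 0 1 := by ext; simp [hQ]
    rw [this, Filter.iInter_mem]
    intro i
    refine ContinuousAt.preimage_mem_nhds (by fun_prop) (Ico_mem_nhds ?_ ?_) <;> norm_num
  have hfin (v : Site d) : ∀ᵐ ω ∂P, X ω ((fun x => x + v) ⁻¹' Q) < ⊤ := by
    have hmap : ∀ π : Measure (Site d), π ((fun x => x + v) ⁻¹' Q) =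
        π.map (IsometryEquiv.addRight v) Q := fun π =>
      (Measure.map_apply (IsometryEquiv.addRight v).continuous.measurable hQm).symm
    simp only [hmap]
    refine ae_lt_top ?_ ?_
    · exact (Measure.measurable_coe hQm).comp ((Measure.measurable_map _
        (IsometryEquiv.continuous _).measurable).comp hX.measurable)
    · rw [hinv.lintegral_map hX.measurable (F := fun π => π Q) (Measure.measurable_coe hQm)]
      exact hint.ne
  have hall : ∀ᵐ ω ∂P, ∀ n : ℕ,
      X ω ((fun x => x + TopologicalSpace.denseSeq (Site d) n) ⁻¹' Q) < ⊤ :=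
    ae_all_iff.2 fun n => hfin _
  filter_upwards [hX.ae_simple, hall] with ω hω hlt
  refine ⟨hω, .of_nhds fun z => ?_⟩
  have hnear : {v : Site d | z + v ∈ interior Q} ∈ nhds (c - z) := by
    refine ContinuousAt.preimage_mem_nhds (f := fun v => z + v) (by fun_prop) ?_
    rw [add_sub_cancel]
    exact interior_mem_nhds.2 hc
  obtain ⟨_, ⟨n, rfl⟩, hv⟩ := (TopologicalSpace.denseRange_denseSeq (Site d)).inter_nhds_nonempty hnear
  refine ⟨_, ContinuousAt.preimage_mem_nhds (f := fun x => x + TopologicalSpace.denseSeq (Site d) n)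
    (by fun_prop) (mem_interior_iff_mem_nhds.1 hv), ?_⟩
  have := hlt n
  rw [hω.apply, Measure.count_apply_lt_top, inter_comm] at this
  exact this

theorem alloc_siteRadius_map (α : ℝ≥0∞) (π : Measure (Site d)) (T : Site d ≃ᵢ Site d)
    (x : Site d) :
    alloc (support (π.map T)) (siteRadius α (support (π.map T))) (T x) =
      (alloc (support π) (siteRadius α (support π)) x).map T := by
  rw [support_map, alloc_image, siteRadius_image]

theorem alloc_centerRadius_map (α : ℝ≥0∞) (π : Measure (Site d)) (T : Site d ≃ᵢ Site d)
    (x : Site d) :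
    alloc (support (π.map T)) (centerRadius α (support (π.map T))) (T x) =
      (alloc (support π) (centerRadius α (support π)) x).map T := by
  rw [support_map, alloc_image, centerRadius_image]

/-- The site-optimal and the center-optimal allocation of a stationary point process almost
surely give almost every site a center at the same distance. -/
theorem ae_score_centerRadius_eq_score_siteRadius (hd : 1 ≤ d) [IsProbabilityMeasure P]
    (hX : IsSimplePointProcess P X) (hinv : IsTranslationInvariant P X)
    (hint : intensity P X < ⊤) {α : ℝ≥0∞} (hα : α ≠ ⊤) :
    ∀ᵐ ω ∂P, ∀ᵐ x : Site d,
      score x (alloc (support (X ω)) (centerRadius α (support (X ω))) x) =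
        score x (alloc (support (X ω)) (siteRadius α (support (X ω))) x) := by
  obtain ⟨h, hpos, hmeas, hlt⟩ :=
    -- An integrable weight replaces the unit cube. Its strict positivity lets equality of weighted
    -- integrals control almost every site.
    exists_pos_lintegral_lt_of_sigmaFinite (volume : Measure (Site d)) one_ne_zero
  set c := ∫⁻ x : Site d, (h x : ℝ≥0∞) with hc
  have hmeas' : Measurable fun x => (h x : ℝ≥0∞) := hmeas.coe_nnreal_ennreal
  have hctop : c ≠ ⊤ := (hlt.trans_le le_top).ne
  have hc0 : c ≠ 0 := by
    rw [hc, Ne, lintegral_eq_zero_iff hmeas']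
    intro h0
    obtain ⟨x, hx⟩ := h0.exists
    exact (hpos x).ne' (by simpa using hx)
  -- Passing through `toConfiguration` makes covariance and joint measurability hold for all
  -- measures, as mass transport requires.
  let As (π : Measure (Site d)) :=
    alloc (support (toConfiguration π)) (siteRadius α (support (toConfiguration π)))
  let Ac (π : Measure (Site d)) :=
    alloc (support (toConfiguration π)) (centerRadius α (support (toConfiguration π)))
  have hAs : Measurable fun q : Measure (Site d) × Site d => As q.1 q.2 :=
    measurable_alloc_support measurable_toConfiguration isConfiguration_toConfiguration
      (R := fun π => siteRadius α (support (toConfiguration π)))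
      (measurable_siteRadius measurable_toConfiguration isConfiguration_toConfiguration α)
  have hAc : Measurable fun q : Measure (Site d) × Site d => Ac q.1 q.2 :=
    measurable_alloc_support measurable_toConfiguration isConfiguration_toConfiguration
      (R := fun π => centerRadius α (support (toConfiguration π)))
      (measurable_centerRadius measurable_toConfiguration isConfiguration_toConfiguration α)
  have hlf (π : Measure (Site d)) : IsLocallyFinite (support (toConfiguration π)) :=
    (isConfiguration_toConfiguration π).2
  have hle (π : Measure (Site d)) : ∀ ξ ∈ support (toConfiguration π),
      centerRadius α (support (toConfiguration π)) ξ ≤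
        siteRadius α (support (toConfiguration π)) ξ :=
    (isBalanced_centerRadius hd α (hlf π).countable).le_siteRadius
  have hsite (π : Measure (Site d)) : (fun x => (h x : ℝ≥0∞) * score x (Ac π x)) ≤ᵐ[volume]
      fun x => (h x : ℝ≥0∞) * score x (As π x) := by
    filter_upwards [ae_score_alloc_le_score_alloc (hlf π) (hle π)] with x hx
    exact mul_le_mul_right hx _
  have hcenter (π : Measure (Site d)) :
      ∫⁻ x, atCenter (fun ξ => (h ξ : ℝ≥0∞)) (As π x) * score x (As π x) ≤
        ∫⁻ x, atCenter (fun ξ => (h ξ : ℝ≥0∞)) (Ac π x) * score x (Ac π x) :=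
    lintegral_atCenter_mul_score_le (hlf π).countable hα
      (isBalanced_centerRadius hd α (hlf π).countable) (isBalanced_siteRadius hd α (hlf π))
      (hle π) _
  have hint_le (A : Measure (Site d) → Site d → Allot d) (π : Measure (Site d)) :
      ∫⁻ x, (h x : ℝ≥0∞) * score x (A π x) ≤ c :=
    lintegral_mono fun x => mul_le_of_le_one_right' (score_le_one _ _)
  have hmS (A : Measure (Site d) → Site d → Allot d)
      (hA : Measurable fun q : Measure (Site d) × Site d => A q.1 q.2) :
      Measurable fun q : Ω × Site d => (h q.2 : ℝ≥0∞) * score q.2 (A (X q.1) q.2) :=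
    (hmeas'.comp measurable_snd).mul (measurable_score measurable_snd
      (hA.comp ((hX.measurable.comp measurable_fst).prodMk measurable_snd)))
  -- Mass transport turns the site weights into center weights, where the center-optimal allocation
  -- wins. Sites give the reverse inequality pointwise, so equality holds.
  have hmean : ∫⁻ ω, (∫⁻ x, (h x : ℝ≥0∞) * score x (As (X ω) x)) ∂P ≤
      ∫⁻ ω, (∫⁻ x, (h x : ℝ≥0∞) * score x (Ac (X ω) x)) ∂P := by
    rw [lintegral_mul_score_eq hX.measurable hinv hAs ?_ hmeas' hc0 hctop,
      lintegral_mul_score_eq hX.measurable hinv hAc ?_ hmeas' hc0 hctop]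
    · exact lintegral_mono fun ω => hcenter (X ω)
    · intro π v x
      simp only [Ac, toConfiguration_map]
      exact alloc_centerRadius_map α _ _ x
    · intro π v x
      simp only [As, toConfiguration_map]
      exact alloc_siteRadius_map α _ _ x
  have hae : (fun ω => ∫⁻ x, (h x : ℝ≥0∞) * score x (Ac (X ω) x)) =ᵐ[P]
      fun ω => ∫⁻ x, (h x : ℝ≥0∞) * score x (As (X ω) x) := by
    refine ae_eq_of_ae_le_of_lintegral_le (.of_forall fun ω => lintegral_mono_ae (hsite (X ω)))
      ?_ (hmS As hAs).lintegral_prod_right'.aemeasurable hmean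
    refine ne_top_of_le_ne_top hctop ((lintegral_mono fun ω => hint_le Ac (X ω)).trans ?_)
    simp
  filter_upwards [hae, ae_isConfiguration hX hinv hint] with ω hω hconf
  have hpt := ae_eq_of_ae_le_of_lintegral_le (hsite (X ω))
    (ne_top_of_le_ne_top hctop (hint_le Ac (X ω)))
    ((hmS As hAs).comp (measurable_prodMk_left (x := ω))).aemeasurable hω.ge
  filter_upwards [hpt] with x hx
  have := (ENNReal.mul_right_inj (by simpa using (hpos x).ne') ENNReal.coe_ne_top).1 hx
  simpa only [As, Ac, toConfiguration_eq hconf] using this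

end PointProcesses

end StableMarriage

/-! ### Uniqueness and the factor allocation. -/

theorem theorem3 {d : ℕ} (hd : 1 ≤ d) {Ω : Type*} [MeasurableSpace Ω]
    (P : Measure Ω) [IsProbabilityMeasure P] (X : Ω → Measure (StableMarriage.Site d))
    (hX : StableMarriage.IsSimplePointProcess P X)
    (hinv : StableMarriage.IsTranslationInvariant P X)
    (hint : StableMarriage.intensity P X < ∞)
    (α : ℝ≥0∞) (hα : 0 < α) (hα' : α < ∞) :
    (∀ᵐ ω ∂P, ∃ ψ : StableMarriage.Site d → StableMarriage.Allot d,
      StableMarriage.IsStableAllocation α (StableMarriage.support (X ω)) ψ ∧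
        ∀ ψ' : StableMarriage.Site d → StableMarriage.Allot d,
          StableMarriage.IsStableAllocation α (StableMarriage.support (X ω)) ψ' →
            ψ' =ᵐ[volume] ψ) ∧
    ∃ (D : Set (Measure (StableMarriage.Site d)))
      (Ψ : Measure (StableMarriage.Site d) → StableMarriage.Site d → StableMarriage.Allot d),
      StableMarriage.IsFactorAllocation α P X D Ψ ∧
        StableMarriage.IsIsometryEquivariant D Ψ ∧
        ∀ᵐ ω ∂P, StableMarriage.IsStableAllocation α (StableMarriage.support (X ω)) (Ψ (X ω)) := by
  have hstable {π : Measure (StableMarriage.Site d)} (h : StableMarriage.IsConfiguration π) :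
      StableMarriage.IsStableAllocation α (StableMarriage.support π)
        (StableMarriage.alloc (StableMarriage.support π)
          (StableMarriage.siteRadius α (StableMarriage.support π))) :=
    (StableMarriage.isBalanced_siteRadius hd α h.2).isStableAllocation h.2
  have hconf := StableMarriage.ae_isConfiguration hX hinv hint
  have hequiv : StableMarriage.IsIsometryEquivariant (d := d) {π | StableMarriage.IsConfiguration π}
      fun π => StableMarriage.alloc (StableMarriage.support π)
        (StableMarriage.siteRadius α (StableMarriage.support π)) := fun T =>
    ⟨fun π => StableMarriage.isConfiguration_map_iff T,
      fun π _ x => StableMarriage.alloc_siteRadius_map α π T x⟩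
  refine ⟨?_, {π | StableMarriage.IsConfiguration π}, _,
    ⟨StableMarriage.measurableSet_isConfiguration, fun π h => h.1, hconf,
      fun π h => (hstable h).1, ?_, fun v => hequiv _⟩, hequiv, ?_⟩
  · filter_upwards [hconf, StableMarriage.ae_score_centerRadius_eq_score_siteRadius hd hX hinv hint
      hα'.ne] with ω h hscore
    exact ⟨_, hstable h, fun ψ' hψ' => hψ'.ae_eq_alloc_siteRadius hd h.2 hscore⟩
  · exact StableMarriage.measurable_alloc_support
      (π := fun π : {π : Measure (StableMarriage.Site d) // StableMarriage.IsConfiguration π} => π.1)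
      measurable_subtype_coe (fun π => π.2)
      (R := fun π => StableMarriage.siteRadius α (StableMarriage.support π.1))
      (StableMarriage.measurable_siteRadius measurable_subtype_coe (fun π => π.2) α)
  · filter_upwards [hconf] with ω h using hstable h
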